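/- **Setting.** Let $Z$ be a real Hilbert space with a compatible complex structure $\sigma$ and a countable unitary basis $(z_k)_{1\le k\le m}$ of $(Z,\sigma)$, $m\in\{0,1,2,\dots\}\cup\{\infty\}$ (for $m=\infty$, $k$ runs over $1,2,\dots$), so that $\{z_k,\sigma(z_k)\}_k$ is a real orthonormal basis of $Z$. Let $C(Z)$ be the real Clifford algebra with relations $zw+wz+2(z,w)1=0$. Let $X=\{0,1\}^m$ be the group of sequences $x=(x_1,x_2,\dots)$ under componentwise addition mod $2$, with the $\sigma$-algebra generated by the sets $\{x: x_k=1\}$; let $\delta_k\in X$ have $k$-th component $1$ and all others $0$, let $\Delta$ be the subgroup of sequences with finitely many ones, and put $\mathbf 1-x=(1-x_1,1-x_2,\dots)$. For $n\in\{1,2,\dots,\infty\}$ let $H_n\subseteq\ell^2(\mathbb N,\mathbb C)$ be the closed span of the first $n$ basis vectors ($H_\infty=\ell^2$). Let $(\mu,\nu,\{c_k\})$ be a triple in which * $\mu$ is a $\sigma$-finite positive measure on $X$ such that for every $\delta\in\Delta$ the translate $\mu_\delta(E)=\mu(E+\delta)$ has the same null sets as $\mu$; * $\nu:X\to\{1,2,\dots\}\cup\{\infty\}$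 is measurable and, for every $\delta\in\Delta$, $\nu(x+\delta)=\nu(x)$ for almost all $x$; put $H_x=H_{\nu(x)}$, so that $H_{x+\delta}=H_x$ for almost all $x$; * for each $k$, $c_k(x)$ is a unitary operator of $H_x=H_{x+\delta_k}$ for almost all $x$, depending measurably on $x$, with $c_k(x)^*=c_k(x+\delta_k)$ and $c_k(x)c_l(x+\delta_k)=c_l(x)c_k(x+\delta_l)$ for all $k,l$ and almost all $x$. The associated Gårding–Wightman module is the complex Hilbert space $H=\int_X^\oplus H_x\,d\mu(x)$ with the representation $\mathbb J$ of $C(Z)$ given by the bounded operators $$(\mathbb J_{z_k}f)(x)=(-1)^{x_1+\dots+x_{k-1}+1}\,i\,c_k(x)\sqrt{\frac{d\mu_{\delta_k}}{d\mu}(x)}\;f(x+\delta_k),\qquad(\mathbb J_{\sigma(z_k)}f)(x)=(-1)^{x_k}\,i\,(\mathbb J_{z_k}f)(x),$$ extended to all $z\in Z$ by $\mathbb J_z=\sum_k (z_k,z)\,\mathbb J_{z_k}+(\sigma(z_k),z)\,\mathbb J_{\sigma(z_k)}$. A $C(Z)$-invariant real form of $H$ is a closed real subspace $V\subseteq H$,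 stable under $C(Z)$, on which the inner product of $H$ takes real values and such that $H=V\oplus iV$. **Theorem.** $H$ has a $C(Z)$-invariant real form if and only if the following three conditions hold: 1. $\mu$ and its reflection $\tilde\mu(E)=\mu(\mathbf 1-E)$ have the same null sets; 2. $\nu(\mathbf 1-x)=\nu(x)$ for almost all $x\in X$ (so that $H_{\mathbf 1-x}=H_x$ for almost all $x$); 3. there is a measurable family of operators $r(x):H_x\to H_{\mathbf 1-x}=H_x$ which, for almost all $x$, are antilinear and norm-preserving and satisfy, for all $k$, $$r(x)\,r(\mathbf 1-x)=1,\qquad r(x)\,c_k(\mathbf 1-x)=(-1)^k\,c_k(x)\,r(x+\delta_k).$$ -/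

import Mathlib

open MeasureTheory
open scoped ENNReal

noncomputable section

namespace GW

/-! ### Clifford representations from anticommuting complex structures -/

section Clifford

variable {ι Z H : Type*} [NormedAddCommGroup Z] [InnerProductSpace ℝ Z]
  [NormedAddCommGroup H] [InnerProductSpace ℝ H]

/-- The quadratic form `z ↦ -|z|²`; its Clifford algebra has the relations
`z₁ z₂ + z₂ z₁ + 2 (z₁, z₂) 1 = 0`. -/
def negNormSq (Z : Type*) [NormedAddCommGroup Z] [InnerProductSpace ℝ Z] : QuadraticForm ℝ Z :=
  -LinearMap.BilinMap.toQuadraticMap (innerₗ Z)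

theorem negNormSq_apply (z : Z) : negNormSq Z z = -‖z‖ ^ 2 := by
  simp [negNormSq]

variable {T : ι → H →ₗᵢ[ℝ] H}

theorem inner_left_eq (hsq : ∀ i f, T i (T i f) = -f) (i : ι) (f g : H) :
    inner ℝ (T i f) g = -inner ℝ f (T i g) := by
  have : g = T i (-(T i g)) := by rw [map_neg, hsq, neg_neg]
  rw [this, LinearIsometry.inner_map_map, inner_neg_right, ← this]

theorem orthogonalFamily (hsq : ∀ i f, T i (T i f) = -f)
    (hac : ∀ i j, i ≠ j → ∀ f, T i (T j f) = -T j (T i f)) (f : H) :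
    OrthogonalFamily ℝ (fun _ : ι => Submodule.span ℝ {f})
      (fun i => (T i).comp (Submodule.span ℝ {f}).subtypeₗᵢ) := by
  intro i j hij v w
  obtain ⟨a, ha⟩ := Submodule.mem_span_singleton.1 v.2
  obtain ⟨b, hb⟩ := Submodule.mem_span_singleton.1 w.2
  have h1 : inner ℝ (T i f) (T j f) = 0 := by
    have e1 := inner_left_eq hsq i f (T j f)
    have e2 := inner_left_eq hsq j f (T i f)
    rw [hac i j hij, inner_neg_right, neg_neg] at e1
    rw [real_inner_comm, e1] at e2
    linarith
  simp [← ha, ← hb, inner_smul_left, inner_smul_right, h1]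

theorem summable_coeff (b : HilbertBasis ι ℝ Z) [CompleteSpace H]
    (hsq : ∀ i f, T i (T i f) = -f)
    (hac : ∀ i j, i ≠ j → ∀ f, T i (T j f) = -T j (T i f)) (z : Z) (f : H) :
    Summable fun i => inner ℝ (b i) z • T i f := by
  have h := (orthogonalFamily hsq hac f).summable_iff_norm_sq_summable
    (fun i => inner ℝ (b i) z • ⟨f, Submodule.mem_span_singleton_self f⟩)
  simp only [map_smul] at h
  refine h.2 ?_
  have h2 := (b.summable_inner_mul_inner z z).mul_right (‖f‖ ^ 2)
  refine h2.congr fun i => ?_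
  rw [norm_smul, mul_pow, real_inner_comm, Real.norm_eq_abs, sq_abs]
  simp [sq]

theorem norm_tsum_coeff (b : HilbertBasis ι ℝ Z) [CompleteSpace H]
    (hsq : ∀ i f, T i (T i f) = -f)
    (hac : ∀ i j, i ≠ j → ∀ f, T i (T j f) = -T j (T i f)) (z : Z) (f : H) :
    ‖∑' i, inner ℝ (b i) z • T i f‖ = ‖z‖ * ‖f‖ := by
  have h1 := ((summable_coeff b hsq hac z f).hasSum.norm).pow 2
  have h2 : HasSum (fun i => ‖inner ℝ (b i) z • T i f‖ ^ 2) (‖z‖ ^ 2 * ‖f‖ ^ 2) := by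
    have := (b.hasSum_inner_mul_inner z z).mul_right (‖f‖ ^ 2)
    rw [real_inner_self_eq_norm_sq] at this
    refine this.congr_fun fun i => ?_
    rw [norm_smul, mul_pow, real_inner_comm, Real.norm_eq_abs, sq_abs,
      LinearIsometry.norm_map]
    ring
  have h3 : ∀ s : Finset ι, ‖∑ i ∈ s, inner ℝ (b i) z • T i f‖ ^ 2
      = ∑ i ∈ s, ‖inner ℝ (b i) z • T i f‖ ^ 2 := by
    intro s
    have := (orthogonalFamily hsq hac f).norm_sum
      (fun i => inner ℝ (b i) z • ⟨f, Submodule.mem_span_singleton_self f⟩) s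
    simp only [map_smul] at this
    refine this.trans (Finset.sum_congr rfl fun i _ => ?_)
    simp [norm_smul]
  simp only [h3] at h1
  have := tendsto_nhds_unique h1 h2
  rw [← mul_pow] at this
  exact (pow_left_inj₀ (norm_nonneg _) (by positivity) two_ne_zero).1 this

/-- The operator `∑ᵢ (bᵢ, z) Tᵢ` attached to a vector `z` with coordinates `(bᵢ, z)`. -/
def vectorOp (b : HilbertBasis ι ℝ Z) [CompleteSpace H] (T : ι → H →ₗᵢ[ℝ] H)
    (hsq : ∀ i f, T i (T i f) = -f)
    (hac : ∀ i j, i ≠ j → ∀ f, T i (T j f) = -T j (T i f)) : Z →ₗ[ℝ] (H →L[ℝ] H) where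
  toFun z := LinearMap.mkContinuous
    { toFun := fun f => ∑' i, inner ℝ (b i) z • T i f
      map_add' := fun f g => by
        rw [← (summable_coeff b hsq hac z f).tsum_add (summable_coeff b hsq hac z g)]
        simp
      map_smul' := fun a f => by
        rw [RingHom.id_apply, ← (summable_coeff b hsq hac z f).tsum_const_smul]
        simp [smul_comm a] }
    ‖z‖ fun f => (norm_tsum_coeff b hsq hac z f).le
  map_add' z w := by
    ext f
    simp only [LinearMap.mkContinuous_apply, LinearMap.coe_mk, AddHom.coe_mk,
      add_apply]
    rw [← (summable_coeff b hsq hac z f).tsum_add (summable_coeff b hsq hac w f)]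
    simp [inner_add_right, add_smul]
  map_smul' a z := by
    ext f
    simp only [LinearMap.mkContinuous_apply, LinearMap.coe_mk, AddHom.coe_mk,
      smul_apply, RingHom.id_apply]
    rw [← (summable_coeff b hsq hac z f).tsum_const_smul]
    simp [inner_smul_right, mul_smul]

theorem vectorOp_apply (b : HilbertBasis ι ℝ Z) [CompleteSpace H]
    (hsq : ∀ i f, T i (T i f) = -f)
    (hac : ∀ i j, i ≠ j → ∀ f, T i (T j f) = -T j (T i f)) (z : Z) (f : H) :
    vectorOp b T hsq hac z f = ∑' i, inner ℝ (b i) z • T i f := rfl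

theorem vectorOp_mul_self (b : HilbertBasis ι ℝ Z) [CompleteSpace H]
    (hsq : ∀ i f, T i (T i f) = -f)
    (hac : ∀ i j, i ≠ j → ∀ f, T i (T j f) = -T j (T i f)) (z : Z) :
    vectorOp b T hsq hac z * vectorOp b T hsq hac z
      = algebraMap ℝ (H →L[ℝ] H) (negNormSq Z z) := by
  set J := vectorOp b T hsq hac z with hJ
  have hskew : ∀ f g, inner ℝ (J f) g = -inner ℝ f (J g) := by
    intro f g
    have e1 := ((summable_coeff b hsq hac z f).hasSum.mapL ((innerSL ℝ) g))
    have e2 := ((summable_coeff b hsq hac z g).hasSum.mapL ((innerSL ℝ) f)).neg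
    simp only [innerSL_apply_apply, inner_smul_right] at e1 e2
    have e3 := e1.unique (e2.congr_fun fun i => by
      rw [real_inner_comm (T i f) g, inner_left_eq hsq]; ring)
    rw [real_inner_comm]
    exact e3
  have hinner : ∀ f g, inner ℝ (J f) (J g) = ‖z‖ ^ 2 * inner ℝ f g := by
    intro f g
    have hn : ∀ f, ‖J f‖ = ‖z‖ * ‖f‖ := norm_tsum_coeff b hsq hac z
    rw [real_inner_eq_norm_add_mul_self_sub_norm_mul_self_sub_norm_mul_self_div_two,
      real_inner_eq_norm_add_mul_self_sub_norm_mul_self_sub_norm_mul_self_div_two,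
      ← map_add, hn, hn, hn]
    ring
  ext f
  refine ext_inner_right ℝ fun g => ?_
  rw [mul_apply_eq_comp, hskew, hinner, negNormSq_apply]
  simp [ContinuousLinearMap.algebraMap_apply, inner_smul_left, sq, mul_assoc]

/-- The representation of the Clifford algebra of `Z` that sends the vector `z` to
`∑ᵢ (bᵢ, z) Tᵢ`, for orthogonal, mutually anticommuting complex structures `Tᵢ`. -/
def cliffordRep (b : HilbertBasis ι ℝ Z) [CompleteSpace H] (T : ι → H →ₗᵢ[ℝ] H)
    (hsq : ∀ i f, T i (T i f) = -f)
    (hac : ∀ i j, i ≠ j → ∀ f, T i (T j f) = -T j (T i f)) :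
    CliffordAlgebra (negNormSq Z) →ₐ[ℝ] (H →L[ℝ] H) :=
  CliffordAlgebra.lift (negNormSq Z) ⟨vectorOp b T hsq hac, vectorOp_mul_self b hsq hac⟩

end Clifford

/-! ### Occupation numbers -/

/-- The indices `k = 1, 2, …`, bounded by `m` when `m` is finite. -/
abbrev Idx (m : ℕ∞) : Type := {k : ℕ // 1 ≤ k ∧ (k : ℕ∞) ≤ m}

/-- The group `X` of sequences `(x₁, x₂, …)` of zeros and ones under addition modulo `2`. It carries
the product `σ`-algebra, which is generated by the sets `{x | x k = 1}`. -/
abbrev Occ (m : ℕ∞) : Type := Idx m → ZMod 2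

/-- The subgroup `Δ` of the sequences with finitely many ones. -/
def Fin01 (m : ℕ∞) : Set (Occ m) := {x | {k | x k = 1}.Finite}

/-- The sequence `δ_k` with `k`-th component `1` and all others `0`. -/
def delta {m : ℕ∞} (k : Idx m) : Occ m := Pi.single k 1

instance instLocallyFiniteOrderBotIdx (m : ℕ∞) : LocallyFiniteOrderBot (Idx m) := by
  classical infer_instance

/-- `x₁ + … + x_{k-1}`, as a natural number. -/
def partialSum {m : ℕ∞} (k : Idx m) (x : Occ m) : ℕ := ∑ j ∈ Finset.Iio k, (x j).val

/-- The Hilbert space `ℓ²` that contains all the fibres. -/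
abbrev Ell2 : Type := lp (fun _ : ℕ => ℂ) 2

/-- The model `H_n ⊆ ℓ²` of the Hilbert space of dimension `n ∈ {0, 1, …, ∞}`: the vectors
whose coordinates vanish from the `n`-th on (counting from `0`). -/
def fiber (n : ℕ∞) : Submodule ℂ Ell2 where
  carrier := {v | ∀ i : ℕ, n ≤ i → v i = 0}
  add_mem' hu hv i hi := by simp [hu i hi, hv i hi]
  zero_mem' i _ := by simp
  smul_mem' a v hv i hi := by simp [hv i hi]

theorem isClosed_fiber (n : ℕ∞) : IsClosed (fiber n : Set Ell2) := by
  have : (fiber n : Set Ell2) = ⋂ (i : ℕ) (_ : n ≤ i), {v | v i = 0} := by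
    ext v
    simp only [Set.mem_iInter, Set.mem_ofPred_eq]
    rfl
  rw [this]
  refine isClosed_iInter fun i => isClosed_iInter fun _ => ?_
  exact isClosed_eq (lp.evalCLM ℂ (fun _ : ℕ => ℂ) 2 i).continuous continuous_const

/-- `U` restricts to a unitary operator of the closed subspace `F` and vanishes on the orthogonal
complement of `F`. This is how operators of a fibre are regarded as operators on `ℓ²`. -/
structure IsUnitaryOn (F : Submodule ℂ Ell2) (U : Ell2 →L[ℂ] Ell2) : Prop where
  mem : ∀ v ∈ F, U v ∈ F
  norm_eq : ∀ v ∈ F, ‖U v‖ = ‖v‖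
  surj : ∀ w ∈ F, ∃ v ∈ F, U v = w
  zero : ∀ v ∈ Fᗮ, U v = 0

/-- The parameters `(μ, ν, {c_k})` of a Gårding–Wightman module. -/
structure Triple (m : ℕ∞) where
  /-- the measure on occupation numbers -/
  μ : Measure (Occ m)
  sigmaFinite : SigmaFinite μ
  /-- all translates of `μ` by `Δ` have the same null sets; as `-δ = δ`, the measure
  `E ↦ μ (E + δ)` is the image of `μ` under `x ↦ x + δ` -/
  quasiInvariant : ∀ δ ∈ Fin01 m, μ.map (· + δ) ≪ μ ∧ μ ≪ μ.map (· + δ)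
  /-- the multiplicity function, with values in `{1, 2, …, ∞}` -/
  ν : Occ m → ℕ∞
  measurable_ν : Measurable ν
  one_le_ν : ∀ x, 1 ≤ ν x
  ν_invariant : ∀ δ ∈ Fin01 m, ∀ᵐ x ∂μ, ν (x + δ) = ν x
  /-- the unitary operators `c_k(x)` of `H_x = H_{x + δ_k}` -/
  c : Idx m → Occ m → (Ell2 →L[ℂ] Ell2)
  measurable_c : ∀ k v, StronglyMeasurable fun x => c k x v
  unitary_c : ∀ k, ∀ᵐ x ∂μ, IsUnitaryOn (fiber (ν x)) (c k x)
  adjoint_c : ∀ k, ∀ᵐ x ∂μ, ContinuousLinearMap.adjoint (c k x) = c k (x + delta k)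
  comm_c : ∀ k l, ∀ᵐ x ∂μ,
    (c k x) ∘L (c l (x + delta k)) = (c l x) ∘L (c k (x + delta l))

variable {m : ℕ∞}

theorem Occ.add_self (x : Occ m) : x + x = 0 := by
  ext k
  exact CharTwo.add_self_eq_zero (x k)

theorem Occ.add_add_cancel (x y : Occ m) : x + y + y = x := by
  rw [add_assoc, Occ.add_self, add_zero]

theorem delta_mem (k : Idx m) : delta k ∈ Fin01 m := by
  refine (Set.finite_singleton k).subset fun j hj => ?_
  by_contra h
  simp [delta, Pi.single_eq_of_ne (show j ≠ k from h)] at hj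

/-- Translation by `δ` as a measurable automorphism of `X`. -/
def translate (δ : Occ m) : Occ m ≃ᵐ Occ m := MeasurableEquiv.addRight δ

namespace Triple

variable (T : Triple m)

instance instSigmaFinite : SigmaFinite T.μ := T.sigmaFinite

instance instSigmaFiniteMap (δ : Occ m) : SigmaFinite (T.μ.map (· + δ)) :=
  (translate δ).sigmaFinite_map

theorem quasiMeasurePreserving {δ : Occ m} (hδ : δ ∈ Fin01 m) :
    Measure.QuasiMeasurePreserving (· + δ) T.μ T.μ :=
  ⟨measurable_add_const δ, (T.quasiInvariant δ hδ).1⟩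

/-- A property that holds almost everywhere holds at almost every translate. -/
theorem ae_translate {p : Occ m → Prop} {δ : Occ m} (hδ : δ ∈ Fin01 m) (h : ∀ᵐ x ∂T.μ, p x) :
    ∀ᵐ x ∂T.μ, p (x + δ) :=
  (T.quasiMeasurePreserving hδ).ae h

/-- The Radon–Nikodym derivative `dμ(x + δ) / dμ(x)`. -/
def density (δ : Occ m) : Occ m → ℝ≥0∞ := (T.μ.map (· + δ)).rnDeriv T.μ

theorem density_cocycle {δ δ' : Occ m} (hδ : δ ∈ Fin01 m) (hδ' : δ' ∈ Fin01 m) :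
    ∀ᵐ x ∂T.μ, T.density δ x * T.density δ' (x + δ)
      = (T.μ.map (· + (δ + δ'))).rnDeriv T.μ x := by
  have hmap : (T.μ.map (· + δ')).map (· + δ) = T.μ.map (· + (δ + δ')) := by
    rw [Measure.map_map (measurable_add_const _) (measurable_add_const _)]
    congr 1; ext x; simp [add_assoc, add_comm δ]
  have h1 := Measure.rnDeriv_mul_rnDeriv (κ := T.μ) (μ := T.μ.map (· + (δ + δ')))
    (ν := T.μ.map (· + δ)) (by
      rw [← hmap]; exact (T.quasiInvariant δ' hδ').1.map (measurable_add_const δ))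
  have h2 := T.ae_translate hδ ((translate δ).measurableEmbedding.rnDeriv_map
    (T.μ.map (· + δ')) T.μ)
  filter_upwards [h1, h2] with x h1 h2
  rw [← h1, Pi.mul_apply, mul_comm]
  congr 1
  rw [density, ← h2]
  change ((T.μ.map (· + δ')).map (· + δ)).rnDeriv (T.μ.map (· + δ)) (x + δ + δ) = _
  rw [hmap, Occ.add_add_cancel]

theorem density_mul_self {δ : Occ m} (hδ : δ ∈ Fin01 m) :
    ∀ᵐ x ∂T.μ, T.density δ x * T.density δ (x + δ) = 1 := by
  filter_upwards [T.density_cocycle hδ hδ, T.μ.rnDeriv_self] with x h1 h2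
  rw [h1, Occ.add_self]
  simpa using h2

theorem density_comm {δ δ' : Occ m} (hδ : δ ∈ Fin01 m) (hδ' : δ' ∈ Fin01 m) :
    ∀ᵐ x ∂T.μ, T.density δ x * T.density δ' (x + δ)
      = T.density δ' x * T.density δ (x + δ') := by
  filter_upwards [T.density_cocycle hδ hδ', T.density_cocycle hδ' hδ] with x h1 h2
  rw [h1, h2, add_comm]

/-- `∫ g(x + δ) dμ(x + δ)/dμ(x) dμ(x) = ∫ g dμ`. -/
theorem lintegral_density {δ : Occ m} (hδ : δ ∈ Fin01 m) {g : Occ m → ℝ≥0∞}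
    (hg : AEMeasurable g T.μ) :
    ∫⁻ x, T.density δ x * g (x + δ) ∂T.μ = ∫⁻ x, g x ∂T.μ := by
  refine (lintegral_rnDeriv_mul (T.quasiInvariant δ hδ).1
    (hg.comp_quasiMeasurePreserving (T.quasiMeasurePreserving hδ))).trans ?_
  refine (lintegral_map_equiv _ (translate δ)).trans ?_
  refine lintegral_congr fun x => ?_
  change g (x + δ + δ) = g x
  rw [Occ.add_add_cancel]

/-- The direct integral `∫⊕ H_x dμ(x)`: the square integrable `f : X → ℓ²` with `f(x) ∈ H_x`
almost everywhere, where `H_x = H_{ν(x)}`. -/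
def space : Submodule ℂ (Lp Ell2 2 T.μ) where
  carrier := {f | ∀ᵐ x ∂T.μ, f x ∈ fiber (T.ν x)}
  add_mem' {f g} hf hg := by
    filter_upwards [hf, hg, Lp.coeFn_add f g] with x h1 h2 h3
    rw [h3]; exact add_mem h1 h2
  zero_mem' := by
    filter_upwards [Lp.coeFn_zero Ell2 2 T.μ] with x h
    rw [h]; exact zero_mem _
  smul_mem' a f hf := by
    filter_upwards [hf, Lp.coeFn_smul a f] with x h1 h2
    rw [h2]; exact Submodule.smul_mem _ a h1

theorem isClosed_space : IsClosed (T.space : Set (Lp Ell2 2 T.μ)) := by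
  refine IsSeqClosed.isClosed fun u f hu hf => ?_
  obtain ⟨ns, _, hns⟩ := (tendstoInMeasure_of_tendsto_Lp hf).exists_seq_tendsto_ae
  have hu' : ∀ᵐ x ∂T.μ, ∀ n, u n x ∈ fiber (T.ν x) := ae_all_iff.2 hu
  change ∀ᵐ x ∂T.μ, f x ∈ fiber (T.ν x)
  filter_upwards [hns, hu'] with x h1 h2
  exact (isClosed_fiber _).mem_of_tendsto h1 (Filter.Eventually.of_forall fun n => h2 _)

/-- The complex Hilbert space `H = ∫⊕ H_x dμ(x)`. -/
def Space : Type := T.space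

instance instNormedAddCommGroup : NormedAddCommGroup T.Space :=
  inferInstanceAs (NormedAddCommGroup T.space)

instance instInnerProductSpace : InnerProductSpace ℂ T.Space :=
  inferInstanceAs (InnerProductSpace ℂ T.space)

/-- The underlying real Hilbert space, with inner product `Re (f, g)`. -/
instance instRealInnerProductSpace : InnerProductSpace ℝ T.Space :=
  InnerProductSpace.complexToReal

instance instCompleteSpace : CompleteSpace T.Space :=
  T.isClosed_space.completeSpace_coe

end Triple

/-- Pointwise application of a strongly measurable family of operators to a strongly measurable
function. -/
theorem stronglyMeasurable_apply {A : Occ m → (Ell2 →L[ℂ] Ell2)}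
    (hA : ∀ v, StronglyMeasurable fun x => A x v) {f : Occ m → Ell2} (hf : StronglyMeasurable f) :
    StronglyMeasurable fun x => A x (f x) := by
  refine stronglyMeasurable_of_tendsto Filter.atTop (f := fun n x => A x (hf.approx n x)) ?_ ?_
  · intro n
    have : (fun x => A x (hf.approx n x)) = fun x => ∑ v ∈ (hf.approx n).range,
        (hf.approx n ⁻¹' {v}).indicator (fun x => A x v) x := by
      ext1 x
      rw [Finset.sum_eq_single (hf.approx n x)]
      · simp
      · intro v _ hv
        exact Set.indicator_of_notMem (fun h => hv (by simpa using h.symm)) _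
      · intro h; exact absurd (SimpleFunc.mem_range_self _ x) h
    rw [this]
    exact Finset.stronglyMeasurable_fun_sum _ fun v _ =>
      (hA v).indicator (SimpleFunc.measurableSet_fiber _ _)
  · rw [tendsto_pi_nhds]
    intro x
    exact ((A x).continuous.tendsto _).comp (hf.tendsto_approx x)


namespace Triple

variable (T : Triple m)

/-- The function `x ↦ a(x) √(dμ(x + δ_k)/dμ(x)) c_k(x) f(x + δ_k)`. -/
def opFun (a : Occ m → ℂ) (k : Idx m) (f : Occ m → Ell2) (x : Occ m) : Ell2 :=
  (a x * (Real.sqrt (T.density (delta k) x).toReal : ℂ)) • T.c k x (f (x + delta k))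

theorem aestronglyMeasurable_opFun {a : Occ m → ℂ} (ha : Measurable a) (k : Idx m)
    {f : Occ m → Ell2} (hf : AEStronglyMeasurable f T.μ) :
    AEStronglyMeasurable (T.opFun a k f) T.μ := by
  obtain ⟨g, hg, hfg⟩ := hf
  refine ⟨T.opFun a k g, ?_, ?_⟩
  · have hd : Measurable (T.density (delta k)) := Measure.measurable_rnDeriv _ _
    have hs : Measurable fun x => a x * (Real.sqrt (T.density (delta k) x).toReal : ℂ) := by
      fun_prop
    exact hs.stronglyMeasurable.smul
      (stronglyMeasurable_apply (T.measurable_c k) (hg.comp_measurable (measurable_add_const _)))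
  · filter_upwards [T.ae_translate (delta_mem k) hfg] with x hx
    simp only [opFun, hx]

theorem opFun_congr (a : Occ m → ℂ) (k : Idx m) {f g : Occ m → Ell2} (h : f =ᵐ[T.μ] g) :
    T.opFun a k f =ᵐ[T.μ] T.opFun a k g := by
  filter_upwards [T.ae_translate (delta_mem k) h] with x hx
  simp only [opFun, hx]

theorem translate_mem_fiber (k : Idx m) {f : Occ m → Ell2}
    (hf : ∀ᵐ x ∂T.μ, f x ∈ fiber (T.ν x)) :
    ∀ᵐ x ∂T.μ, f (x + delta k) ∈ fiber (T.ν x) := by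
  filter_upwards [T.ae_translate (delta_mem k) hf, T.ν_invariant _ (delta_mem k)] with x h1 h2
  rwa [h2] at h1

theorem opFun_mem_fiber (a : Occ m → ℂ) (k : Idx m) {f : Occ m → Ell2}
    (hf : ∀ᵐ x ∂T.μ, f x ∈ fiber (T.ν x)) :
    ∀ᵐ x ∂T.μ, T.opFun a k f x ∈ fiber (T.ν x) := by
  filter_upwards [T.translate_mem_fiber k hf, T.unitary_c k] with x h1 h2
  exact Submodule.smul_mem _ _ (h2.mem _ h1)

theorem eLpNorm_opFun {a : Occ m → ℂ} (ha : ∀ x, ‖a x‖ = 1) (k : Idx m) {f : Occ m → Ell2}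
    (hfm : AEStronglyMeasurable f T.μ) (hf : ∀ᵐ x ∂T.μ, f x ∈ fiber (T.ν x)) :
    eLpNorm (T.opFun a k f) 2 T.μ = eLpNorm f 2 T.μ := by
  rw [eLpNorm_eq_lintegral_rpow_enorm_toReal two_ne_zero ENNReal.ofNat_ne_top,
    eLpNorm_eq_lintegral_rpow_enorm_toReal two_ne_zero ENNReal.ofNat_ne_top]
  congr 1
  rw [← T.lintegral_density (delta_mem k) (hfm.enorm.pow_const _)]
  refine lintegral_congr_ae ?_
  filter_upwards [T.translate_mem_fiber k hf, T.unitary_c k,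
    Measure.rnDeriv_lt_top (T.μ.map (· + delta k)) T.μ] with x h1 h2 h3
  change T.density (delta k) x < ∞ at h3
  have e1 : ‖T.opFun a k f x‖ₑ
      = ENNReal.ofReal (Real.sqrt (T.density (delta k) x).toReal) * ‖f (x + delta k)‖ₑ := by
    rw [opFun, ← ofReal_norm, ← ofReal_norm, ← ENNReal.ofReal_mul (Real.sqrt_nonneg _), norm_smul,
      h2.norm_eq _ h1, norm_mul, ha, one_mul, Complex.norm_real, Real.norm_of_nonneg
        (Real.sqrt_nonneg _)]
  rw [e1]
  simp only [ENNReal.toReal_ofNat, ENNReal.rpow_ofNat]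
  rw [mul_pow, ← ENNReal.ofReal_pow (Real.sqrt_nonneg _), Real.sq_sqrt ENNReal.toReal_nonneg,
    ENNReal.ofReal_toReal h3.ne]

theorem memLp_opFun {a : Occ m → ℂ} (ha : Measurable a) (ha' : ∀ x, ‖a x‖ = 1) (k : Idx m)
    (f : T.Space) : MemLp (T.opFun a k f.1) 2 T.μ :=
  ⟨T.aestronglyMeasurable_opFun ha k (Lp.aestronglyMeasurable f.1), by
    rw [T.eLpNorm_opFun ha' k (Lp.aestronglyMeasurable f.1) f.2]
    exact Lp.eLpNorm_lt_top f.1⟩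

/-- The operator `f ↦ a(x) √(dμ(x + δ_k)/dμ(x)) c_k(x) f(x + δ_k)` of the direct integral, for a
function `a` of modulus one. -/
def op (a : Occ m → ℂ) (ha : Measurable a) (ha' : ∀ x, ‖a x‖ = 1) (k : Idx m) :
    T.Space →ₗᵢ[ℂ] T.Space where
  toFun f := ⟨(T.memLp_opFun ha ha' k f).toLp (T.opFun a k f.1), by
    have h := T.opFun_mem_fiber a k f.2
    filter_upwards [h, (T.memLp_opFun ha ha' k f).coeFn_toLp] with x h1 h2
    rwa [h2]⟩
  map_add' f g := by
    refine Subtype.ext (Lp.ext ?_)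
    refine (MemLp.coeFn_toLp (T.memLp_opFun ha ha' k (f + g))).trans ?_
    refine .trans ?_ (Lp.coeFn_add _ _).symm
    filter_upwards [T.ae_translate (delta_mem k) (Lp.coeFn_add f.1 g.1),
      (T.memLp_opFun ha ha' k f).coeFn_toLp, (T.memLp_opFun ha ha' k g).coeFn_toLp] with x h h1 h2
    rw [Pi.add_apply, h1, h2]
    change _ • T.c k x ((f.1 + g.1 : Lp Ell2 2 T.μ) (x + delta k)) = _
    simp only [opFun, h, Pi.add_apply, map_add, smul_add]
  map_smul' r f := by
    refine Subtype.ext (Lp.ext ?_)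
    refine (MemLp.coeFn_toLp (T.memLp_opFun ha ha' k (r • f))).trans ?_
    refine .trans ?_ (Lp.coeFn_smul _ _).symm
    filter_upwards [T.ae_translate (delta_mem k) (Lp.coeFn_smul r f.1),
      (T.memLp_opFun ha ha' k f).coeFn_toLp] with x h h1
    rw [RingHom.id_apply, Pi.smul_apply, h1]
    change _ • T.c k x ((r • f.1 : Lp Ell2 2 T.μ) (x + delta k)) = _
    simp only [opFun, h, Pi.smul_apply, map_smul]
    rw [smul_comm]
  norm_map' f := by
    change ‖(T.memLp_opFun ha ha' k f).toLp (T.opFun a k f.1)‖ = ‖f.1‖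
    rw [Lp.norm_toLp, T.eLpNorm_opFun ha' k (Lp.aestronglyMeasurable f.1) f.2, Lp.norm_def]

theorem op_apply (a : Occ m → ℂ) (ha : Measurable a) (ha' : ∀ x, ‖a x‖ = 1) (k : Idx m)
    (f : T.Space) : (T.op a ha ha' k f).1 =ᵐ[T.μ] T.opFun a k f.1 :=
  (T.memLp_opFun ha ha' k f).coeFn_toLp

theorem op_op_apply (a : Occ m → ℂ) (ha : Measurable a) (ha' : ∀ x, ‖a x‖ = 1) (k : Idx m)
    (b : Occ m → ℂ) (hb : Measurable b) (hb' : ∀ x, ‖b x‖ = 1) (l : Idx m) (f : T.Space) :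
    ∀ᵐ x ∂T.μ, (T.op a ha ha' k (T.op b hb hb' l f)).1 x
      = (a x * b (x + delta k) * (Real.sqrt (T.density (delta k) x *
          T.density (delta l) (x + delta k)).toReal : ℂ)) •
        (T.c k x ∘L T.c l (x + delta k)) (f.1 (x + delta k + delta l)) := by
  filter_upwards [T.op_apply a ha ha' k (T.op b hb hb' l f),
    T.opFun_congr a k (T.op_apply b hb hb' l f)] with x h1 h2
  rw [h1, h2]
  simp only [opFun, map_smul, smul_smul, ENNReal.toReal_mul,
    Real.sqrt_mul ENNReal.toReal_nonneg, ContinuousLinearMap.comp_apply]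
  congr 1
  push_cast
  ring

theorem op_op_self (a : Occ m → ℂ) (ha : Measurable a) (ha' : ∀ x, ‖a x‖ = 1) (k : Idx m)
    (haa : ∀ x, a x * a (x + delta k) = -1) (f : T.Space) :
    T.op a ha ha' k (T.op a ha ha' k f) = -f := by
  refine Subtype.ext (Lp.ext ?_)
  refine .trans ?_ (Lp.coeFn_neg _).symm
  filter_upwards [T.op_op_apply a ha ha' k a ha ha' k f, T.density_mul_self (delta_mem k),
    T.adjoint_c k, T.unitary_c k, T.ae_translate (delta_mem k) (T.unitary_c k),
    f.2, T.ν_invariant _ (delta_mem k)] with x h1 h2 h3 h4 h5 h6 h7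
  rw [h1, h2, haa, Occ.add_add_cancel]
  have : (T.c k x ∘L T.c k (x + delta k)) (f.1 x) = f.1 x := by
    rw [h7, ← h3] at h5
    rw [← h3]
    obtain ⟨v, hv, hvw⟩ := h4.surj _ h6
    have hadj : ∀ u ∈ fiber (T.ν x), ContinuousLinearMap.adjoint (T.c k x) (T.c k x u) = u := by
      intro u hu
      have hmem := h5.mem _ (h4.mem _ hu)
      rw [← sub_eq_zero, ← norm_eq_zero, ← sq_eq_zero_iff]
      have e := @norm_sub_sq ℂ _ _ _ _
        (ContinuousLinearMap.adjoint (T.c k x) (T.c k x u)) u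
      rw [ContinuousLinearMap.adjoint_inner_left, h5.norm_eq _ (h4.mem _ hu), h4.norm_eq _ hu,
        inner_self_eq_norm_sq, h4.norm_eq _ hu] at e
      rw [e]; ring
    rw [ContinuousLinearMap.comp_apply, ← hvw, hadj v hv]
  rw [this]
  simp

theorem op_op_anti (a : Occ m → ℂ) (ha : Measurable a) (ha' : ∀ x, ‖a x‖ = 1) (k : Idx m)
    (b : Occ m → ℂ) (hb : Measurable b) (hb' : ∀ x, ‖b x‖ = 1) (l : Idx m)
    (hab : ∀ x, a x * b (x + delta k) = -(b x * a (x + delta l))) (f : T.Space) :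
    T.op a ha ha' k (T.op b hb hb' l f) = -T.op b hb hb' l (T.op a ha ha' k f) := by
  refine Subtype.ext (Lp.ext ?_)
  refine .trans ?_ (Lp.coeFn_neg _).symm
  filter_upwards [T.op_op_apply a ha ha' k b hb hb' l f, T.op_op_apply b hb hb' l a ha ha' k f,
    T.density_comm (delta_mem k) (delta_mem l), T.comm_c k l] with x h1 h2 h3 h4
  rw [Pi.neg_apply, h1, h2, hab, h3, h4, add_right_comm, neg_mul, neg_smul]

end Triple

/-! ### The representation -/

/-- The factor `(-1)^(x₁ + … + x_{k-1} + 1) i` of the operator `J_{z_k}`. -/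
def phaseZ (k : Idx m) (x : Occ m) : ℂ := (-1) ^ (partialSum k x + 1) * Complex.I

/-- The factor `(-1)^(x_k) i · (-1)^(x₁ + … + x_{k-1} + 1) i` of the operator `J_{σ(z_k)}`. -/
def phaseS (k : Idx m) (x : Occ m) : ℂ := (-1) ^ (x k).val * Complex.I * phaseZ k x

theorem measurable_phaseZ (k : Idx m) : Measurable (phaseZ k) := by
  have : Measurable (partialSum k) :=
    Finset.measurable_fun_sum _ fun j _ =>
      (measurable_of_countable (fun a : ZMod 2 => a.val)).comp (measurable_pi_apply j)
  exact (measurable_of_countable (fun n : ℕ => (-1 : ℂ) ^ (n + 1) * Complex.I)).comp this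

theorem measurable_phaseS (k : Idx m) : Measurable (phaseS k) :=
  ((measurable_of_countable (fun a : ZMod 2 => (-1 : ℂ) ^ a.val * Complex.I)).comp
    (measurable_pi_apply k)).mul (measurable_phaseZ k)

theorem norm_phaseZ (k : Idx m) (x : Occ m) : ‖phaseZ k x‖ = 1 := by simp [phaseZ]

theorem norm_phaseS (k : Idx m) (x : Occ m) : ‖phaseS k x‖ = 1 := by
  simp [phaseS, norm_phaseZ]

theorem sign_add_one (a : ZMod 2) : (-1 : ℂ) ^ (a + 1).val = -(-1) ^ a.val := by
  fin_cases a
  · change (-1 : ℂ) ^ 1 = -(-1) ^ 0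
    simp
  · change (-1 : ℂ) ^ 0 = -(-1) ^ 1
    simp

theorem sign_add_delta (k l : Idx m) (x : Occ m) :
    (-1 : ℂ) ^ ((x + delta l) k).val = (if l = k then -1 else 1) * (-1) ^ (x k).val := by
  by_cases h : l = k
  · subst h
    simp [delta, sign_add_one]
  · simp [delta, h]

theorem phaseZ_add_delta (k l : Idx m) (x : Occ m) :
    phaseZ k (x + delta l) = (if l < k then -1 else 1) * phaseZ k x := by
  have : (-1 : ℂ) ^ partialSum k (x + delta l)
      = (if l < k then -1 else 1) * (-1) ^ partialSum k x := by
    simp only [partialSum, ← Finset.prod_pow_eq_pow_sum, sign_add_delta, Finset.prod_mul_distrib]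
    simp [Finset.prod_ite_eq]
  rw [phaseZ, phaseZ, pow_succ, pow_succ, this]
  ring

theorem phaseS_add_delta (k l : Idx m) (x : Occ m) :
    phaseS k (x + delta l)
      = (if l = k then -1 else 1) * (if l < k then -1 else 1) * phaseS k x := by
  rw [phaseS, phaseS, phaseZ_add_delta, sign_add_delta]
  ring

theorem phaseZ_sq (k : Idx m) (x : Occ m) : phaseZ k x * phaseZ k x = -1 := by
  rw [phaseZ, mul_mul_mul_comm, ← mul_pow, Complex.I_mul_I]; simp

theorem phaseS_sq (k : Idx m) (x : Occ m) : phaseS k x * phaseS k x = 1 := by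
  rw [phaseS, mul_mul_mul_comm, phaseZ_sq, mul_mul_mul_comm, ← mul_pow, Complex.I_mul_I]; simp

namespace Triple

variable (T : Triple m)

/-- `(J_{z_k} f)(x) = (-1)^(x₁ + … + x_{k-1} + 1) i c_k(x) √(dμ(x + δ_k)/dμ(x)) f(x + δ_k)`. -/
def opZ (k : Idx m) : T.Space →ₗᵢ[ℂ] T.Space :=
  T.op (phaseZ k) (measurable_phaseZ k) (norm_phaseZ k) k

/-- `(J_{σ(z_k)} f)(x) = (-1)^(x_k) i (J_{z_k} f)(x)`. -/
def opS (k : Idx m) : T.Space →ₗᵢ[ℂ] T.Space :=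
  T.op (phaseS k) (measurable_phaseS k) (norm_phaseS k) k

/-- All the generators: `J_{z_k}` for `inl k` and `J_{σ(z_k)}` for `inr k`, regarded as operators
of the underlying real Hilbert space. -/
def generator : Idx m ⊕ Idx m → (T.Space →ₗᵢ[ℝ] T.Space)
  | .inl k => { (T.opZ k).toLinearMap.restrictScalars ℝ with norm_map' := (T.opZ k).norm_map }
  | .inr k => { (T.opS k).toLinearMap.restrictScalars ℝ with norm_map' := (T.opS k).norm_map }

theorem generator_sq (p : Idx m ⊕ Idx m) (f : T.Space) :
    T.generator p (T.generator p f) = -f := by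
  rcases p with k | k
  · refine T.op_op_self (phaseZ k) (measurable_phaseZ k) (norm_phaseZ k) k
      (fun x => ?_) f
    rw [phaseZ_add_delta, if_neg (lt_irrefl k), one_mul, phaseZ_sq]
  · refine T.op_op_self (phaseS k) (measurable_phaseS k) (norm_phaseS k) k
      (fun x => ?_) f
    rw [phaseS_add_delta, if_neg (lt_irrefl k), if_pos rfl, mul_one, mul_left_comm, phaseS_sq,
      mul_one]

theorem generator_anti (p q : Idx m ⊕ Idx m) (hpq : p ≠ q) (f : T.Space) :
    T.generator p (T.generator q f) = -T.generator q (T.generator p f) := by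
  rcases p with k | k <;> rcases q with l | l
  · refine T.op_op_anti (phaseZ k) (measurable_phaseZ k) (norm_phaseZ k) k
      (phaseZ l) (measurable_phaseZ l) (norm_phaseZ l) l (fun x => ?_) f
    have hkl : k ≠ l := fun h => hpq (by rw [h])
    rw [phaseZ_add_delta, phaseZ_add_delta]
    rcases hkl.lt_or_gt with h | h <;> simp [h, h.not_gt] <;> ring
  · refine T.op_op_anti (phaseZ k) (measurable_phaseZ k) (norm_phaseZ k) k
      (phaseS l) (measurable_phaseS l) (norm_phaseS l) l (fun x => ?_) f
    rw [phaseS_add_delta, phaseZ_add_delta]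
    rcases lt_trichotomy k l with h | h | h
    · simp [h, h.not_gt, h.ne]; ring
    · subst h; simp; ring
    · simp [h, h.not_gt, h.ne']; ring
  · refine T.op_op_anti (phaseS k) (measurable_phaseS k) (norm_phaseS k) k
      (phaseZ l) (measurable_phaseZ l) (norm_phaseZ l) l (fun x => ?_) f
    rw [phaseS_add_delta, phaseZ_add_delta]
    rcases lt_trichotomy k l with h | h | h
    · simp [h, h.not_gt, h.ne']; ring
    · subst h; simp; ring
    · simp [h, h.not_gt, h.ne]; ring
  · refine T.op_op_anti (phaseS k) (measurable_phaseS k) (norm_phaseS k) k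
      (phaseS l) (measurable_phaseS l) (norm_phaseS l) l (fun x => ?_) f
    have hkl : k ≠ l := fun h => hpq (by rw [h])
    rw [phaseS_add_delta, phaseS_add_delta]
    rcases hkl.lt_or_gt with h | h <;> simp [h, h.not_gt, hkl, hkl.symm] <;> ring

/-- The Gårding–Wightman representation `J` of the Clifford algebra `C(Z)` on the direct integral.
The real Hilbert space `Z` comes with an orthonormal basis `b`, where `b (inl k) = z_k` and
`b (inr k) = σ(z_k)` for a compatible complex structure `σ` and a unitary basis `z_1, z_2, …`
of `(Z, σ)`; the vector `z` acts by
`J_z = ∑_k (z_k, z) J_{z_k} + (σ(z_k), z) J_{σ(z_k)}`. -/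
def rep {Z : Type*} [NormedAddCommGroup Z] [InnerProductSpace ℝ Z]
    (b : HilbertBasis (Idx m ⊕ Idx m) ℝ Z) :
    CliffordAlgebra (negNormSq Z) →ₐ[ℝ] (T.Space →L[ℝ] T.Space) :=
  cliffordRep (H := T.Space) b T.generator T.generator_sq T.generator_anti

end Triple

/-- `V` is a `C(Z)`-invariant real form of the complex Hilbert space `H`: a closed real subspace
on which the inner product of `H` is real, with `H = V ⊕ iV` (so that `H` is the complexification
of the real Hilbert space `V`), which is stable under the action `J` of `C(Z)`. -/
structure IsInvariantRealForm {Z H : Type*} [NormedAddCommGroup Z] [InnerProductSpace ℝ Z]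
    [NormedAddCommGroup H] [InnerProductSpace ℂ H]
    (J : CliffordAlgebra (negNormSq Z) →ₐ[ℝ] (H →L[ℝ] H)) (V : Submodule ℝ H) : Prop where
  closed : IsClosed (V : Set H)
  real_inner : ∀ u ∈ V, ∀ v ∈ V, (inner ℂ u v).im = 0
  decomp : ∀ f : H, ∃! p : V × V, (p.1 : H) + Complex.I • (p.2 : H) = f
  invariant : ∀ a, ∀ v ∈ V, J a v ∈ V

end GW

end

noncomputable section

namespace GW

/-! ### Real forms and antilinear involutions -/

section RealForm

open ComplexConjugate

variable {H : Type*} [NormedAddCommGroup H] [InnerProductSpace ℂ H]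

/-! An invariant real form `V` amounts to an antilinear isometric involution `R` commuting with all
generators: `R` is `u + iv ↦ u - iv`, and `V` is its fixed space (`isInvariantRealForm_fixedPoints`,
`exists_conjIsometry`). The question is therefore which such `R` exist on the direct integral.

The product of the operators of `σ(z_k)` and `z_k` is multiplication by `-(-1)^(x_k) i`. Since `R`
commutes with it but conjugates `i`, it must interchange the sets `x_k = 0` and `x_k = 1`.
Orthogonality and countable unions extend this to the whole σ-algebra: `R` carries sections
supported in `E` to sections supported in `1 - E` (`reflects_of_measurableSet`, `map_cut`). So the
measure class is invariant under reflection, and the antiunitarity of `R` localizes to an identity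
between inner products in the fibres (`inner_map_map_ae`). Applying `R` to sections that run through
the standard basis of the fibres then produces orthonormal fields (`exists_orthonormal_fields`).
They force `ν(1 - x) = ν(x)` by a dimension count, and they are the columns of antilinear isometries
`r(x)` with `(Rf)(x) = √(dμ(1 - x)/dμ(x)) r(x) f(1 - x)` (`exists_isReflection`).

In terms of `r`, the identity `R² = 1` reads `r(x) r(1 - x) = 1`, and commutation with the
generators is the relation between `r` and `c_k`. The sign there has two sources: reflection flips
the `k - 1` occupation numbers in the phase of the generator, and conjugating `i` adds one more sign
(`conj_phaseZ_add_one`). Conversely, a family `r` defines `R` by the same formula, and the relations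
make it an involution commuting with the generators (`reflection_reflection`, `reflection_op`). -/

/-- An antilinear isometry conjugates the inner product. -/
theorem inner_conjIsometry (R : H →ₛₗᵢ[starRingEnd ℂ] H) (f g : H) :
    inner ℂ (R f) (R g) = conj (inner ℂ f g) := by
  -- Pulling `i` through `R` swaps the two imaginary terms of the polarization identity and fixes
  -- the two real ones; this is complex conjugation.
  have h1 : R f - Complex.I • R g = R (f + Complex.I • g) := by
    rw [map_add, LinearIsometry.map_smulₛₗ]; simp [sub_eq_add_neg]
  have h2 : R f + Complex.I • R g = R (f - Complex.I • g) := by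
    rw [map_sub, LinearIsometry.map_smulₛₗ]; simp
  rw [inner_eq_sum_norm_sq_div_four, inner_eq_sum_norm_sq_div_four]
  simp only [RCLike.I_to_complex, Complex.coe_algebraMap, h1, h2, ← map_add, ← map_sub,
    LinearIsometry.norm_map]
  simp only [map_div₀, map_add, map_sub, map_mul, map_pow, Complex.conj_I, Complex.conj_ofReal,
    map_ofNat]
  ring

/-- The real subspace of the fixed points of an antilinear isometry. -/
def fixedPoints (R : H →ₛₗᵢ[starRingEnd ℂ] H) : Submodule ℝ H where
  carrier := {f | R f = f}
  add_mem' {f g} hf hg := by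
    change R (f + g) = f + g
    rw [map_add, show R f = f from hf, show R g = g from hg]
  zero_mem' := map_zero R
  smul_mem' a f hf := by
    change R (a • f) = a • f
    rw [← Complex.coe_smul, LinearIsometry.map_smulₛₗ, Complex.conj_ofReal,
      show R f = f from hf]

theorem mem_fixedPoints {R : H →ₛₗᵢ[starRingEnd ℂ] H} {f : H} :
    f ∈ fixedPoints R ↔ R f = f := Iff.rfl

theorem isClosed_fixedPoints (R : H →ₛₗᵢ[starRingEnd ℂ] H) :
    IsClosed (fixedPoints R : Set H) :=
  isClosed_eq R.continuous continuous_id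

/-- The fixed points of an antilinear isometric involution form a real form. -/
theorem isInvariantRealForm_fixedPoints {Z : Type*} [NormedAddCommGroup Z]
    [InnerProductSpace ℝ Z] {J : CliffordAlgebra (negNormSq Z) →ₐ[ℝ] (H →L[ℝ] H)}
    (R : H →ₛₗᵢ[starRingEnd ℂ] H) (hR : ∀ f, R (R f) = f)
    (hJ : ∀ a, ∀ v ∈ fixedPoints R, J a v ∈ fixedPoints R) :
    IsInvariantRealForm J (fixedPoints R) where
  closed := isClosed_fixedPoints R
  real_inner u hu v hv := by
    have h := inner_conjIsometry R u v
    rw [mem_fixedPoints.1 hu, mem_fixedPoints.1 hv] at h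
    exact Complex.conj_eq_iff_im.1 h.symm
  decomp f := by
    have hI : ∀ g : H, R (Complex.I • g) = -(Complex.I • R g) := fun g => by
      rw [LinearIsometry.map_smulₛₗ]; simp
    have hr : ∀ (c : ℝ) (g : H), R ((c : ℂ) • g) = (c : ℂ) • R g := fun c g => by
      rw [LinearIsometry.map_smulₛₗ, Complex.conj_ofReal]
    -- Real and imaginary parts with respect to `R`: `(f + Rf)/2` and `(f - Rf)/(2i) = i(Rf - f)/2`.
    refine ⟨(⟨((2⁻¹ : ℝ) : ℂ) • (f + R f), ?_⟩,
      ⟨((2⁻¹ : ℝ) : ℂ) • (Complex.I • (R f - f)), ?_⟩), ?_, ?_⟩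
    · rw [mem_fixedPoints, hr, map_add, hR, add_comm]
    · rw [mem_fixedPoints, hr, hI, map_sub, hR, ← smul_neg, neg_sub]
    · simp only [smul_smul]
      rw [show Complex.I * (((2⁻¹ : ℝ) : ℂ) * Complex.I) = -((2⁻¹ : ℝ) : ℂ) by
        linear_combination ((2⁻¹ : ℝ) : ℂ) * Complex.I_mul_I, neg_smul, ← smul_neg, neg_sub,
        ← smul_add, add_add_sub_cancel, ← two_smul ℂ, smul_smul]
      simp
    · rintro ⟨⟨u, hu⟩, ⟨v, hv⟩⟩ rfl
      have e : R (u + Complex.I • v) = u - Complex.I • v := by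
        rw [map_add, hI, mem_fixedPoints.1 hu, mem_fixedPoints.1 hv, sub_eq_add_neg]
      refine Prod.ext (Subtype.ext ?_) (Subtype.ext ?_)
      · change u = ((2⁻¹ : ℝ) : ℂ) • (u + Complex.I • v + R (u + Complex.I • v))
        rw [e, add_add_sub_cancel, ← two_smul ℂ, smul_smul]
        simp
      · change v = ((2⁻¹ : ℝ) : ℂ) • (Complex.I • (R (u + Complex.I • v) - (u + Complex.I • v)))
        rw [e, show u - Complex.I • v - (u + Complex.I • v) = (-2 * Complex.I) • v by module,
          smul_smul, smul_smul, show ((2⁻¹ : ℝ) : ℂ) * Complex.I * (-2 * Complex.I) = 1 by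
            push_cast; linear_combination -Complex.I_mul_I, one_smul]
  invariant := hJ

/-- A real form is the set of fixed points of an antilinear isometric involution, which commutes
with every complex linear operator that preserves the real form. -/
theorem IsInvariantRealForm.exists_conjIsometry {Z : Type*} [NormedAddCommGroup Z]
    [InnerProductSpace ℝ Z] {J : CliffordAlgebra (negNormSq Z) →ₐ[ℝ] (H →L[ℝ] H)}
    {V : Submodule ℝ H} (hV : IsInvariantRealForm J V) :
    ∃ R : H →ₛₗᵢ[starRingEnd ℂ] H, (∀ f, R (R f) = f) ∧
      ∀ G : H →ₗ[ℂ] H, (∀ v ∈ V, G v ∈ V) → ∀ f, R (G f) = G (R f) := by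
  choose p hp hu using hV.decomp
  have key : ∀ u ∈ V, ∀ v ∈ V, ((p (u + Complex.I • v)).1 : H) = u ∧
      ((p (u + Complex.I • v)).2 : H) = v := fun u hu' v hv' => by
    have := hu (u + Complex.I • v) (⟨u, hu'⟩, ⟨v, hv'⟩) rfl
    rw [← this]; exact ⟨rfl, rfl⟩
  let R0 : H → H := fun f => ((p f).1 : H) - Complex.I • ((p f).2 : H)
  have hR0 : ∀ u ∈ V, ∀ v ∈ V, R0 (u + Complex.I • v) = u - Complex.I • v :=
    fun u hu' v hv' => by
      change ((p (u + Complex.I • v)).1 : H) - Complex.I • ((p (u + Complex.I • v)).2 : H) = _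
      rw [(key u hu' v hv').1, (key u hu' v hv').2]
  have hex : ∀ f : H, ∃ u ∈ V, ∃ v ∈ V, f = u + Complex.I • v :=
    fun f => ⟨_, (p f).1.2, _, (p f).2.2, (hp f).symm⟩
  let R : H →ₛₗᵢ[starRingEnd ℂ] H :=
    { toFun := R0
      map_add' := fun f g => by
        obtain ⟨u, hu, v, hv, rfl⟩ := hex f
        obtain ⟨u', hu', v', hv', rfl⟩ := hex g
        rw [show u + Complex.I • v + (u' + Complex.I • v')
          = (u + u') + Complex.I • (v + v') by module, hR0 _ (add_mem hu hu') _ (add_mem hv hv'),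
          hR0 _ hu _ hv, hR0 _ hu' _ hv']
        module
      map_smul' := fun a f => by
        obtain ⟨u, hu, v, hv, rfl⟩ := hex f
        obtain ⟨s, t⟩ := a
        have e1 : ∀ (w : H), (Complex.mk s t) • w = s • w + Complex.I • (t • w) := fun w => by
          rw [← Complex.coe_smul, ← Complex.coe_smul, smul_smul, ← add_smul]
          congr 1; apply Complex.ext <;> simp
        have e2 : ∀ (w : H), conj (Complex.mk s t) • w = s • w - Complex.I • (t • w) := fun w => by
          rw [← Complex.coe_smul, ← Complex.coe_smul, smul_smul, ← sub_smul]
          congr 1; apply Complex.ext <;> simp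
        have e3 : ∀ w : H, Complex.I • Complex.I • w = -w := fun w => by
          rw [smul_smul, Complex.I_mul_I, neg_one_smul]
        have e4 : Complex.mk s t • (u + Complex.I • v)
            = (s • u - t • v) + Complex.I • (s • v + t • u) := by
          rw [e1]
          simp only [smul_add, smul_comm t Complex.I, e3, smul_comm s Complex.I]
          abel
        rw [e4, hR0 _ (sub_mem (V.smul_mem s hu) (V.smul_mem t hv)) _
          (add_mem (V.smul_mem s hv) (V.smul_mem t hu)), hR0 _ hu _ hv, e2]
        simp only [smul_add, smul_sub, smul_comm t Complex.I, e3, smul_comm s Complex.I]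
        abel
      norm_map' := fun f => by
        obtain ⟨u, hu, v, hv, rfl⟩ := hex f
        change ‖R0 _‖ = _
        -- The cross term is `Re (i (u, v))`, which vanishes because `(u, v)` is real on `V`.
        rw [hR0 _ hu _ hv, ← sq_eq_sq₀ (norm_nonneg _) (norm_nonneg _), @norm_sub_sq ℂ,
          @norm_add_sq ℂ, inner_smul_right]
        simp [hV.real_inner u hu v hv] }
  have hR : ∀ u ∈ V, ∀ v ∈ V, R (u + Complex.I • v) = u - Complex.I • v := hR0
  refine ⟨R, fun f => ?_, fun G hG f => ?_⟩
  · obtain ⟨u, hu, v, hv, rfl⟩ := hex f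
    rw [hR _ hu _ hv, sub_eq_add_neg, ← smul_neg, hR _ hu _ (neg_mem hv), smul_neg, sub_neg_eq_add]
  · obtain ⟨u, hu, v, hv, rfl⟩ := hex f
    rw [hR _ hu _ hv, map_add, map_smul, hR _ (hG u hu) _ (hG v hv), map_sub, map_smul]

end RealForm

/-! ### Stability under the Clifford algebra -/

namespace Triple

variable {m : ℕ∞} (T : Triple m) {Z : Type*} [NormedAddCommGroup Z] [InnerProductSpace ℝ Z]
  (b : HilbertBasis (Idx m ⊕ Idx m) ℝ Z)

theorem rep_ι (z : Z) (f : T.Space) :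
    T.rep b (CliffordAlgebra.ι _ z) f = ∑' p, inner ℝ (b p) z • T.generator p f := by
  rw [rep, cliffordRep, CliffordAlgebra.lift_ι_apply]
  rfl

theorem rep_ι_basis (p : Idx m ⊕ Idx m) (f : T.Space) :
    T.rep b (CliffordAlgebra.ι _ (b p)) f = T.generator p f := by
  classical
  rw [rep_ι, tsum_eq_single p]
  · rw [orthonormal_iff_ite.1 b.orthonormal, if_pos rfl, one_smul]
  · intro q hq
    rw [orthonormal_iff_ite.1 b.orthonormal, if_neg hq, zero_smul]

/-- A closed real subspace that is stable under the generators is stable under `C(Z)`. -/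
theorem rep_mem {V : Submodule ℝ T.Space} (hV : IsClosed (V : Set T.Space))
    (h : ∀ p, ∀ v ∈ V, T.generator p v ∈ V) (a : CliffordAlgebra (negNormSq Z)) :
    ∀ v ∈ V, T.rep b a v ∈ V := by
  induction a using CliffordAlgebra.induction with
  | algebraMap r =>
    intro v hv
    rw [AlgHom.commutes]
    exact V.smul_mem r hv
  | ι z =>
    intro v hv
    rw [rep_ι]
    -- A general vector acts by an infinite series of generators, so closedness of `V` is needed
    -- here.
    exact hV.mem_of_tendsto
      (summable_coeff b T.generator_sq T.generator_anti z v).hasSum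
      (.of_forall fun s => V.sum_mem fun p _ => V.smul_mem _ (h p v hv))
  | mul a a' ha ha' =>
    intro v hv
    rw [map_mul]
    exact ha _ (ha' v hv)
  | add a a' ha ha' =>
    intro v hv
    rw [map_add]
    exact V.add_mem (ha v hv) (ha' v hv)

end Triple

open ComplexConjugate

variable {m : ℕ∞}

/-! ### The reflection of occupation numbers -/

theorem Occ.one_sub_eq (x : Occ m) : 1 - x = x + 1 := by
  have h : ∀ a : ZMod 2, 1 - a = a + 1 := by decide
  exact funext fun k => h (x k)

/-- Indices start at `1`, so `k` has `k - 1` predecessors; this count decides the parity in the sign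
`(-1)^k`. -/
theorem card_Iio (k : Idx m) : (Finset.Iio k).card + 1 = (k : ℕ) := by
  have h : (Finset.Iio k).map (Function.Embedding.subtype _) = Finset.Ico 1 (k : ℕ) := by
    ext j
    simp only [Finset.mem_map, Finset.mem_Iio, Function.Embedding.coe_subtype, Finset.mem_Ico]
    constructor
    · rintro ⟨i, hi, rfl⟩
      exact ⟨i.2.1, hi⟩
    · rintro ⟨h1, h2⟩
      exact ⟨⟨j, h1, (Nat.cast_le.2 h2.le).trans k.2.2⟩, h2, rfl⟩
  have h1 := k.2.1
  rw [← Finset.card_map (Function.Embedding.subtype _), h, Nat.card_Ico]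
  omega

/-- Reflection changes each of the `k - 1` preceding occupation numbers and contributes
`(-1)^(k-1)`; conjugating the factor `i` contributes the remaining sign. -/
theorem conj_phaseZ_add_one (k : Idx m) (x : Occ m) :
    conj (phaseZ k (x + 1)) = (-1) ^ (k : ℕ) * phaseZ k x := by
  have h : (-1 : ℂ) ^ partialSum k (x + 1)
      = (-1) ^ (Finset.Iio k).card * (-1) ^ partialSum k x := by
    simp only [partialSum, ← Finset.prod_pow_eq_pow_sum, Pi.add_apply, Pi.one_apply, sign_add_one]
    rw [Finset.prod_neg]
  simp only [phaseZ, pow_succ, h, ← card_Iio k]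
  simp only [map_mul, map_pow, map_neg, map_one, Complex.conj_I]
  ring

/-- The extra factor `(-1)^(x_k) i` is invariant, since reflection and conjugation each change its
sign. Hence both kinds of generators lead to the same condition on `r`. -/
theorem conj_phaseS_add_one (k : Idx m) (x : Occ m) :
    conj (phaseS k (x + 1)) = (-1) ^ (k : ℕ) * phaseS k x := by
  rw [phaseS, phaseS, map_mul, conj_phaseZ_add_one, Pi.add_apply, Pi.one_apply, sign_add_one]
  simp only [map_mul, map_pow, map_neg, map_one, Complex.conj_I]
  ring

/-- Pointwise application of a strongly measurable family of continuous maps to a strongly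
measurable function. -/
theorem stronglyMeasurable_apply_of_continuous {A : Occ m → Ell2 → Ell2}
    (hc : ∀ x, Continuous (A x)) (hA : ∀ v, StronglyMeasurable fun x => A x v)
    {f : Occ m → Ell2} (hf : StronglyMeasurable f) :
    StronglyMeasurable fun x => A x (f x) := by
  refine stronglyMeasurable_of_tendsto Filter.atTop (f := fun n x => A x (hf.approx n x)) ?_ ?_
  · intro n
    have : (fun x => A x (hf.approx n x)) = fun x => ∑ v ∈ (hf.approx n).range,
        (hf.approx n ⁻¹' {v}).indicator (fun x => A x v) x := by
      ext1 x
      rw [Finset.sum_eq_single (hf.approx n x)]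
      · simp
      · intro v _ hv
        exact Set.indicator_of_notMem (fun h => hv (by simpa using h.symm)) _
      · intro h; exact absurd (SimpleFunc.mem_range_self _ x) h
    rw [this]
    exact Finset.stronglyMeasurable_fun_sum _ fun v _ =>
      (hA v).indicator (SimpleFunc.measurableSet_fiber _ _)
  · rw [tendsto_pi_nhds]
    intro x
    exact ((hc x).tendsto _).comp (hf.tendsto_approx x)

/-! ### Radon–Nikodym cocycle for the reflection, and the antilinear operator built from `r`. -/

namespace Triple

variable (T : Triple m)

/-- The chain rule for Radon–Nikodym derivatives. Absolute continuity is assumed in place of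
membership in `Δ`, because the constant sequence `1` is not in `Δ` when `m = ∞`. -/
theorem density_mul_translate {δ δ' : Occ m} (hδ : T.μ.map (· + δ) ≪ T.μ)
    (hδ' : T.μ.map (· + δ') ≪ T.μ) :
    ∀ᵐ x ∂T.μ, T.density δ x * T.density δ' (x + δ) = T.density (δ + δ') x := by
  have hmap : (T.μ.map (· + δ')).map (· + δ) = T.μ.map (· + (δ + δ')) := by
    rw [Measure.map_map (measurable_add_const _) (measurable_add_const _)]
    congr 1; ext x; simp [add_assoc, add_comm δ]
  have h1 := Measure.rnDeriv_mul_rnDeriv (κ := T.μ) (μ := T.μ.map (· + (δ + δ')))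
    (ν := T.μ.map (· + δ)) (by rw [← hmap]; exact hδ'.map (measurable_add_const δ))
  have hq : Measure.QuasiMeasurePreserving (· + δ) T.μ T.μ := ⟨measurable_add_const δ, hδ⟩
  have h2 := hq.ae ((translate δ).measurableEmbedding.rnDeriv_map (T.μ.map (· + δ')) T.μ)
  filter_upwards [h1, h2] with x h1 h2
  rw [density, density, density, ← h1, Pi.mul_apply, mul_comm]
  congr 1
  rw [← h2]
  change ((T.μ.map (· + δ')).map (· + δ)).rnDeriv (T.μ.map (· + δ)) (x + δ + δ) = _
  rw [hmap, Occ.add_add_cancel]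

theorem density_mul_translate_self {δ : Occ m} (hδ : T.μ.map (· + δ) ≪ T.μ) :
    ∀ᵐ x ∂T.μ, T.density δ x * T.density δ (x + δ) = 1 := by
  filter_upwards [T.density_mul_translate hδ hδ, T.μ.rnDeriv_self] with x h1 h2
  rw [h1, Occ.add_self, density]
  simpa using h2

theorem lintegral_density_mul {δ : Occ m} (hδ : T.μ.map (· + δ) ≪ T.μ) {g : Occ m → ℝ≥0∞}
    (hg : AEMeasurable g T.μ) :
    ∫⁻ x, T.density δ x * g (x + δ) ∂T.μ = ∫⁻ x, g x ∂T.μ := by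
  refine (lintegral_rnDeriv_mul hδ
    (hg.comp_quasiMeasurePreserving ⟨measurable_add_const δ, hδ⟩)).trans ?_
  refine (lintegral_map_equiv _ (translate δ)).trans ?_
  refine lintegral_congr fun x => ?_
  change g (x + δ + δ) = g x
  rw [Occ.add_add_cancel]

theorem density_lt_top (δ : Occ m) : ∀ᵐ x ∂T.μ, T.density δ x < ∞ :=
  Measure.rnDeriv_lt_top _ _

/-- The function `x ↦ √(dμ(1 - x)/dμ(x)) r(x) f(1 - x)`. -/
def reflFun (r : Occ m → (Ell2 →L⋆[ℂ] Ell2)) (f : Occ m → Ell2) (x : Occ m) : Ell2 :=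
  (Real.sqrt (T.density 1 x).toReal : ℂ) • r x (f (x + 1))

/-- A measurable family of antilinear isometries of the fibres over a reflection invariant
measure class. -/
structure IsReflection (r : Occ m → (Ell2 →L⋆[ℂ] Ell2)) : Prop where
  ac : T.μ.map (· + 1) ≪ T.μ
  ν_eq : ∀ᵐ x ∂T.μ, T.ν (x + 1) = T.ν x
  meas : ∀ v, StronglyMeasurable fun x => r x v
  isom : ∀ᵐ x ∂T.μ, ∀ v ∈ fiber (T.ν x), r x v ∈ fiber (T.ν x) ∧ ‖r x v‖ = ‖v‖

variable {T} {r : Occ m → (Ell2 →L⋆[ℂ] Ell2)}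

theorem reflFun_reflFun (f : Occ m → Ell2) (x : Occ m) :
    T.reflFun r (T.reflFun r f) x
      = (Real.sqrt (T.density 1 x * T.density 1 (x + 1)).toReal : ℂ) • r x (r (x + 1) (f x)) := by
  simp only [reflFun, ContinuousLinearMap.map_smulₛₗ, smul_smul, ENNReal.toReal_mul,
    Real.sqrt_mul ENNReal.toReal_nonneg, Occ.add_add_cancel, Complex.conj_ofReal,
    Complex.ofReal_mul]

theorem reflFun_opFun (a : Occ m → ℂ) (k : Idx m) (f : Occ m → Ell2) (x : Occ m) :
    T.reflFun r (T.opFun a k f) x = (conj (a (x + 1)) *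
      (Real.sqrt (T.density 1 x * T.density (delta k) (x + 1)).toReal : ℂ)) •
        r x (T.c k (x + 1) (f (x + delta k + 1))) := by
  simp only [reflFun, opFun, ContinuousLinearMap.map_smulₛₗ, smul_smul, ENNReal.toReal_mul,
    Real.sqrt_mul ENNReal.toReal_nonneg, map_mul, Complex.conj_ofReal, Complex.ofReal_mul,
    add_right_comm x 1]
  congr 1
  ring

theorem opFun_reflFun (a : Occ m → ℂ) (k : Idx m) (f : Occ m → Ell2) (x : Occ m) :
    T.opFun a k (T.reflFun r f) x = (a x *
      (Real.sqrt (T.density (delta k) x * T.density 1 (x + delta k)).toReal : ℂ)) •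
        T.c k x (r (x + delta k) (f (x + delta k + 1))) := by
  simp only [reflFun, opFun, map_smul, smul_smul, ENNReal.toReal_mul,
    Real.sqrt_mul ENNReal.toReal_nonneg, Complex.ofReal_mul]
  congr 1
  ring

/-- Both products equal the density of the translation by `1 + δ_k`; thus the square roots never
obstruct commutation of reflection and generators. -/
theorem density_reflect_comm (h1 : T.μ.map (· + 1) ≪ T.μ) (k : Idx m) :
    ∀ᵐ x ∂T.μ, T.density 1 x * T.density (delta k) (x + 1)
      = T.density (delta k) x * T.density 1 (x + delta k) := by
  have hk := (T.quasiInvariant _ (delta_mem k)).1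
  filter_upwards [T.density_mul_translate h1 hk, T.density_mul_translate hk h1] with x e1 e2
  rw [e1, e2, add_comm]

namespace IsReflection

theorem qmp (h : T.IsReflection r) : Measure.QuasiMeasurePreserving (· + 1) T.μ T.μ :=
  ⟨measurable_add_const 1, h.ac⟩

theorem aestronglyMeasurable (h : T.IsReflection r) {f : Occ m → Ell2}
    (hf : AEStronglyMeasurable f T.μ) : AEStronglyMeasurable (T.reflFun r f) T.μ := by
  obtain ⟨g, hg, hfg⟩ := hf
  refine ⟨T.reflFun r g, ?_, ?_⟩
  · have hd : Measurable (T.density 1) := Measure.measurable_rnDeriv _ _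
    have hs : Measurable fun x => (Real.sqrt (T.density 1 x).toReal : ℂ) := by fun_prop
    exact hs.stronglyMeasurable.smul (stronglyMeasurable_apply_of_continuous
      (A := fun x => r x) (fun x => (r x).continuous) h.meas
      (hg.comp_measurable (measurable_add_const _)))
  · filter_upwards [h.qmp.ae hfg] with x hx
    simp only [reflFun, hx]

theorem reflect_mem_fiber (h : T.IsReflection r) {f : Occ m → Ell2}
    (hf : ∀ᵐ x ∂T.μ, f x ∈ fiber (T.ν x)) : ∀ᵐ x ∂T.μ, f (x + 1) ∈ fiber (T.ν x) := by
  filter_upwards [h.qmp.ae hf, h.ν_eq] with x h1 h2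
  rwa [h2] at h1

theorem eLpNorm_reflFun (h : T.IsReflection r) {f : Occ m → Ell2}
    (hfm : AEStronglyMeasurable f T.μ) (hf : ∀ᵐ x ∂T.μ, f x ∈ fiber (T.ν x)) :
    eLpNorm (T.reflFun r f) 2 T.μ = eLpNorm f 2 T.μ := by
  rw [eLpNorm_eq_lintegral_rpow_enorm_toReal two_ne_zero ENNReal.ofNat_ne_top,
    eLpNorm_eq_lintegral_rpow_enorm_toReal two_ne_zero ENNReal.ofNat_ne_top]
  congr 1
  rw [← T.lintegral_density_mul h.ac (hfm.enorm.pow_const _)]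
  refine lintegral_congr_ae ?_
  filter_upwards [h.reflect_mem_fiber hf, h.isom, T.density_lt_top 1] with x h1 h2 h3
  have e1 : ‖T.reflFun r f x‖ₑ
      = ENNReal.ofReal (Real.sqrt (T.density 1 x).toReal) * ‖f (x + 1)‖ₑ := by
    rw [reflFun, ← ofReal_norm, ← ofReal_norm, ← ENNReal.ofReal_mul (Real.sqrt_nonneg _),
      norm_smul, (h2 _ h1).2, Complex.norm_real, Real.norm_of_nonneg (Real.sqrt_nonneg _)]
  rw [e1]
  simp only [ENNReal.toReal_ofNat, ENNReal.rpow_ofNat]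
  rw [mul_pow, ← ENNReal.ofReal_pow (Real.sqrt_nonneg _), Real.sq_sqrt ENNReal.toReal_nonneg,
    ENNReal.ofReal_toReal h3.ne]

theorem memLp_reflFun (h : T.IsReflection r) (f : T.Space) :
    MemLp (T.reflFun r f.1) 2 T.μ :=
  ⟨h.aestronglyMeasurable (Lp.aestronglyMeasurable f.1), by
    rw [h.eLpNorm_reflFun (Lp.aestronglyMeasurable f.1) f.2]
    exact Lp.eLpNorm_lt_top f.1⟩

/-- The antilinear isometry `f ↦ √(dμ(1 - x)/dμ(x)) r(x) f(1 - x)` of the direct integral. -/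
def reflection (h : T.IsReflection r) : T.Space →ₛₗᵢ[starRingEnd ℂ] T.Space where
  toFun f := ⟨(h.memLp_reflFun f).toLp (T.reflFun r f.1), by
    filter_upwards [h.reflect_mem_fiber f.2, h.isom, (h.memLp_reflFun f).coeFn_toLp]
      with x h1 h2 h3
    rw [h3]
    exact Submodule.smul_mem _ _ (h2 _ h1).1⟩
  map_add' f g := by
    refine Subtype.ext (Lp.ext ?_)
    refine (MemLp.coeFn_toLp (h.memLp_reflFun (f + g))).trans ?_
    refine .trans ?_ (Lp.coeFn_add _ _).symm
    filter_upwards [h.qmp.ae (Lp.coeFn_add f.1 g.1),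
      (h.memLp_reflFun f).coeFn_toLp, (h.memLp_reflFun g).coeFn_toLp] with x h0 h1 h2
    rw [Pi.add_apply, h1, h2]
    change _ • r x ((f.1 + g.1 : Lp Ell2 2 T.μ) (x + 1)) = _
    simp only [reflFun, h0, Pi.add_apply, map_add, smul_add]
  map_smul' a f := by
    refine Subtype.ext (Lp.ext ?_)
    refine (MemLp.coeFn_toLp (h.memLp_reflFun (a • f))).trans ?_
    refine .trans ?_ (Lp.coeFn_smul _ _).symm
    filter_upwards [h.qmp.ae (Lp.coeFn_smul a f.1), (h.memLp_reflFun f).coeFn_toLp] with x h0 h1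
    rw [Pi.smul_apply, h1]
    change _ • r x ((a • f.1 : Lp Ell2 2 T.μ) (x + 1)) = _
    simp only [reflFun, h0, Pi.smul_apply, ContinuousLinearMap.map_smulₛₗ]
    rw [smul_comm]
  norm_map' f := by
    change ‖(h.memLp_reflFun f).toLp (T.reflFun r f.1)‖ = ‖f.1‖
    rw [Lp.norm_toLp, h.eLpNorm_reflFun (Lp.aestronglyMeasurable f.1) f.2, Lp.norm_def]

theorem reflection_apply (h : T.IsReflection r) (f : T.Space) :
    (h.reflection f).1 =ᵐ[T.μ] T.reflFun r f.1 :=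
  (h.memLp_reflFun f).coeFn_toLp

theorem reflFun_congr (h : T.IsReflection r) {f g : Occ m → Ell2} (hfg : f =ᵐ[T.μ] g) :
    T.reflFun r f =ᵐ[T.μ] T.reflFun r g := by
  filter_upwards [h.qmp.ae hfg] with x hx
  simp only [reflFun, hx]

theorem reflection_reflection (h : T.IsReflection r)
    (hr : ∀ᵐ x ∂T.μ, ∀ v ∈ fiber (T.ν x), r x (r (x + 1) v) = v) (f : T.Space) :
    h.reflection (h.reflection f) = f := by
  refine Subtype.ext (Lp.ext ?_)
  refine (h.reflection_apply _).trans ((h.reflFun_congr (h.reflection_apply f)).trans ?_)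
  filter_upwards [T.density_mul_translate_self h.ac, hr, f.2] with x h1 h2 h3
  rw [reflFun_reflFun, h1, h2 _ h3]
  simp

/-- The sign from moving `r` past `c_k` cancels the sign from conjugating the reflected phase `a`.
The phase is left general so that both kinds of generators are covered. -/
theorem reflection_op (h : T.IsReflection r) (k : Idx m)
    (hr : ∀ᵐ x ∂T.μ, ∀ v ∈ fiber (T.ν x),
      r x (T.c k (x + 1) v) = (-1 : ℂ) ^ (k : ℕ) • T.c k x (r (x + delta k) v))
    (a : Occ m → ℂ) (ha : Measurable a) (ha' : ∀ x, ‖a x‖ = 1)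
    (hconj : ∀ x, conj (a (x + 1)) = (-1) ^ (k : ℕ) * a x) (f : T.Space) :
    h.reflection (T.op a ha ha' k f) = T.op a ha ha' k (h.reflection f) := by
  refine Subtype.ext (Lp.ext ?_)
  refine (h.reflection_apply _).trans ((h.reflFun_congr (T.op_apply a ha ha' k f)).trans ?_)
  refine .trans ?_ (T.op_apply a ha ha' k _).symm
  refine .trans ?_ (T.opFun_congr a k (h.reflection_apply f)).symm
  filter_upwards [hr, T.translate_mem_fiber k (h.reflect_mem_fiber f.2),
    density_reflect_comm h.ac k] with x h1 h2 h3
  rw [reflFun_opFun, opFun_reflFun, h1 _ h2, h3, hconj, smul_smul]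
  congr 1
  have : (-1 : ℂ) ^ (k : ℕ) * (-1) ^ (k : ℕ) = 1 := by rw [← mul_pow]; simp
  linear_combination (a x * (Real.sqrt (T.density (delta k) x *
    T.density 1 (x + delta k)).toReal : ℂ)) * this

/-- The real form attached to a family `r` that intertwines the operators `c_k`. -/
theorem exists_isInvariantRealForm (h : T.IsReflection r)
    (hr : ∀ᵐ x ∂T.μ, ∀ v ∈ fiber (T.ν x), r x (r (x + 1) v) = v)
    (hc : ∀ k : Idx m, ∀ᵐ x ∂T.μ, ∀ v ∈ fiber (T.ν x),
      r x (T.c k (x + 1) v) = (-1 : ℂ) ^ (k : ℕ) • T.c k x (r (x + delta k) v))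
    {Z : Type*} [NormedAddCommGroup Z] [InnerProductSpace ℝ Z]
    (b : HilbertBasis (Idx m ⊕ Idx m) ℝ Z) :
    ∃ V : Submodule ℝ T.Space, IsInvariantRealForm (T.rep b) V := by
  refine ⟨_, isInvariantRealForm_fixedPoints h.reflection (h.reflection_reflection hr)
    (T.rep_mem b (isClosed_fixedPoints _) ?_)⟩
  rintro (k | k) v hv
  · refine (h.reflection_op k (hc k) (phaseZ k) (measurable_phaseZ k) (norm_phaseZ k)
      (conj_phaseZ_add_one k) v).trans ?_
    rw [mem_fixedPoints.1 hv]
    rfl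
  · refine (h.reflection_op k (hc k) (phaseS k) (measurable_phaseS k) (norm_phaseS k)
      (conj_phaseS_add_one k) v).trans ?_
    rw [mem_fixedPoints.1 hv]
    rfl

end IsReflection

end Triple

namespace Triple

variable (T : Triple m)

/-! ### Localization of an antilinear involution -/

theorem opZ_opZ (k : Idx m) (f : T.Space) : T.opZ k (T.opZ k f) = -f :=
  T.generator_sq (.inl k) f

/-- `J_{σ(z_k)} J_{z_k}` is the multiplication by `-(-1)^(x_k) i`. -/
theorem opS_opZ_apply (k : Idx m) (f : T.Space) :
    ∀ᵐ x ∂T.μ, (T.opS k (T.opZ k f)).1 x = -((-1) ^ (x k).val * Complex.I) • f.1 x := by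
  have h0 : (T.opZ k (T.opZ k f)).1 =ᵐ[T.μ] -f.1 := by
    rw [opZ_opZ]; exact Lp.coeFn_neg f.1
  filter_upwards [T.op_apply (phaseS k) (measurable_phaseS k) (norm_phaseS k) k (T.opZ k f),
    T.op_apply (phaseZ k) (measurable_phaseZ k) (norm_phaseZ k) k (T.opZ k f), h0] with x h1 h2 h3
  refine h1.trans ?_
  -- The two generators differ only by the factor `(-1)^(x_k) i`, so the product reduces to the
  -- square of the first, which is `-1`.
  have h4 : T.opFun (phaseZ k) k (T.opZ k f).1 x = -f.1 x := h2.symm.trans h3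
  rw [neg_smul, ← smul_neg, ← h4, opFun, opFun, phaseS, smul_smul]
  congr 1
  ring

/-- The restriction of an element of the direct integral to a measurable set. -/
def cut (E : Set (Occ m)) (hE : MeasurableSet E) (f : T.Space) : T.Space :=
  ⟨((Lp.memLp f.1).indicator hE).toLp _, by
    filter_upwards [f.2, ((Lp.memLp f.1).indicator hE).coeFn_toLp] with x h1 h2
    rw [h2]
    by_cases hx : x ∈ E
    · rwa [Set.indicator_of_mem hx]
    · rw [Set.indicator_of_notMem hx]
      exact zero_mem _⟩

theorem cut_apply (E : Set (Occ m)) (hE : MeasurableSet E) (f : T.Space) :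
    (T.cut E hE f).1 =ᵐ[T.μ] E.indicator f.1 :=
  ((Lp.memLp f.1).indicator hE).coeFn_toLp

theorem inner_eq_integral (f g : T.Space) :
    inner ℂ f g = ∫ x, inner ℂ (f.1 x) (g.1 x) ∂T.μ :=
  L2.inner_def f.1 g.1

theorem inner_cut_left (E : Set (Occ m)) (hE : MeasurableSet E) (f g : T.Space) :
    inner ℂ (T.cut E hE f) g = ∫ x in E, inner ℂ (f.1 x) (g.1 x) ∂T.μ := by
  rw [inner_eq_integral, ← integral_indicator hE]
  refine integral_congr_ae ?_
  filter_upwards [T.cut_apply E hE f] with x hx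
  rw [hx]
  by_cases h : x ∈ E <;> simp [h]

theorem cut_add_cut_compl (E : Set (Occ m)) (hE : MeasurableSet E) (f : T.Space) :
    T.cut E hE f + T.cut Eᶜ hE.compl f = f := by
  refine Subtype.ext (Lp.ext ?_)
  refine (Lp.coeFn_add _ _).trans ?_
  filter_upwards [T.cut_apply E hE f, T.cut_apply Eᶜ hE.compl f] with x h1 h2
  rw [Pi.add_apply, h1, h2]
  by_cases h : x ∈ E <;> simp [h]

variable {T}

/-- `f` vanishes almost everywhere on `E`. -/
def VanishesOn (f : T.Space) (E : Set (Occ m)) : Prop := ∀ᵐ x ∂T.μ, x ∈ E → f.1 x = 0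

theorem vanishesOn_cut (E : Set (Occ m)) (hE : MeasurableSet E) (f : T.Space) :
    VanishesOn (T.cut E hE f) Eᶜ := by
  filter_upwards [T.cut_apply E hE f] with x h1 h2
  rw [h1, Set.indicator_of_notMem h2]

theorem vanishesOn_of_inner_cut_eq_zero {E : Set (Occ m)} (hE : MeasurableSet E) {f : T.Space}
    (h : inner ℂ (T.cut E hE f) f = 0) : VanishesOn f E := by
  have h1 : inner ℂ (T.cut E hE f) (T.cut E hE f) = (0 : ℂ) := by
    rw [← h, inner_cut_left, inner_cut_left]
    refine setIntegral_congr_ae hE ?_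
    filter_upwards [T.cut_apply E hE f] with x h1 h2
    rw [h1, Set.indicator_of_mem h2]
  rw [inner_self_eq_zero] at h1
  have h2 : (T.cut E hE f).1 =ᵐ[T.μ] 0 := by
    rw [h1]; exact Lp.coeFn_zero _ _ _
  filter_upwards [h2, T.cut_apply E hE f] with x h2 h3 h4
  rw [h3, Set.indicator_of_mem h4] at h2
  exact h2

theorem inner_eq_zero_of_vanishesOn {E : Set (Occ m)} {f g : T.Space} (hf : VanishesOn f E)
    (hg : VanishesOn g Eᶜ) : inner ℂ f g = 0 := by
  rw [inner_eq_integral]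
  refine integral_eq_zero_of_ae ?_
  filter_upwards [hf, hg] with x h1 h2
  by_cases h : x ∈ E
  · simp [h1 h]
  · simp [h2 h]

/-- The reflection `1 - E = E + 1` of a set of occupation numbers. -/
abbrev reflSet (E : Set (Occ m)) : Set (Occ m) := (· + 1) ⁻¹' E

theorem reflSet_reflSet (E : Set (Occ m)) : reflSet (reflSet E) = E := by
  ext x
  simp [Occ.add_add_cancel]

theorem measurableSet_reflSet {E : Set (Occ m)} (hE : MeasurableSet E) :
    MeasurableSet (reflSet E) := measurable_add_const 1 hE

/-- `R` maps the elements that vanish on `E` to elements that vanish on `1 - E`, and conversely. -/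
def Reflects (R : T.Space →ₛₗᵢ[starRingEnd ℂ] T.Space) (E : Set (Occ m)) : Prop :=
  (∀ f, VanishesOn f E → VanishesOn (R f) (reflSet E)) ∧
    ∀ f, VanishesOn f (reflSet E) → VanishesOn (R f) E

variable {R : T.Space →ₛₗᵢ[starRingEnd ℂ] T.Space}

theorem inner_conjInvolution (hR : ∀ f, R (R f) = f) (f g : T.Space) :
    inner ℂ (R f) g = conj (inner ℂ f (R g)) := by
  rw [← inner_conjIsometry, hR]

/-- A duality argument: the part of `Rf` on `Fᶜ` vanishes on `F`, so `R` sends it to something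
vanishing on `E`, hence orthogonal to `f`. Moving `R` across the inner product, this part is
orthogonal to `Rf` and so is zero. -/
theorem vanishesOn_compl (hR : ∀ f, R (R f) = f) {E F : Set (Occ m)} (hF : MeasurableSet F)
    (h : ∀ f, VanishesOn f F → VanishesOn (R f) E) {f : T.Space} (hf : VanishesOn f Eᶜ) :
    VanishesOn (R f) Fᶜ := by
  refine vanishesOn_of_inner_cut_eq_zero hF.compl ?_
  have h1 : VanishesOn (T.cut Fᶜ hF.compl (R f)) F := by
    simpa using vanishesOn_cut Fᶜ hF.compl (R f)
  have h2 := inner_eq_zero_of_vanishesOn (h _ h1) hf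
  rwa [inner_conjInvolution hR, map_eq_zero] at h2

theorem Reflects.compl (hR : ∀ f, R (R f) = f) {E : Set (Occ m)} (hE : MeasurableSet E)
    (h : Reflects R E) : Reflects R Eᶜ :=
  ⟨fun _ hf => vanishesOn_compl hR (measurableSet_reflSet hE) h.2 hf,
    fun _ hf => vanishesOn_compl hR hE h.1 hf⟩

theorem vanishesOn_iUnion {f : T.Space} {E : ℕ → Set (Occ m)} :
    VanishesOn f (⋃ n, E n) ↔ ∀ n, VanishesOn f (E n) := by
  simp only [VanishesOn, ← ae_all_iff, Set.mem_iUnion, forall_exists_index]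

theorem Reflects.iUnion {E : ℕ → Set (Occ m)} (h : ∀ n, Reflects R (E n)) :
    Reflects R (⋃ n, E n) := by
  have e : reflSet (⋃ n, E n) = ⋃ n, reflSet (E n) := Set.preimage_iUnion
  constructor
  · intro f hf
    rw [e, vanishesOn_iUnion]
    exact fun n => (h n).1 f (vanishesOn_iUnion.1 hf n)
  · intro f hf
    rw [e, vanishesOn_iUnion] at hf
    exact vanishesOn_iUnion.2 fun n => (h n).2 f (hf n)

/-- An eigenvalue argument: `f` lives on `x_k = a + 1` and is an eigenvector for `s i`, where `s =
(-1)^a`. By antilinearity `Rf` is an eigenvector for `-s i`, whereas the operator acts as `s i` on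
the set `x_k = a + 1`. -/
theorem vanishesOn_map_coordinate
    (hS : ∀ k f, R (T.opS k (T.opZ k f)) = T.opS k (T.opZ k (R f))) (k : Idx m) (a : ZMod 2)
    {f : T.Space} (hf : VanishesOn f {x | x k = a}) : VanishesOn (R f) {x | x k = a + 1} := by
  set s : ℂ := (-1) ^ a.val with hs
  have hss : s ≠ 0 := by simp [hs]
  have hsr : conj s = s := by simp [hs]
  have hne : ∀ a b : ZMod 2, b ≠ a → b = a + 1 := by decide
  have h1 : T.opS k (T.opZ k f) = (s * Complex.I) • f := by
    refine Subtype.ext (Lp.ext ?_)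
    refine .trans ?_ (Lp.coeFn_smul _ _).symm
    filter_upwards [T.opS_opZ_apply k f, hf] with x h1 h2
    rw [h1, Pi.smul_apply]
    by_cases h : x k = a
    · rw [h2 h, smul_zero, smul_zero]
    · rw [hne _ _ h, sign_add_one, neg_mul, neg_neg]
  have h2 : T.opS k (T.opZ k (R f)) = -((s * Complex.I) • R f) := by
    rw [← hS, h1, LinearIsometry.map_smulₛₗ]
    simp [hsr]
  have h3 : (T.opS k (T.opZ k (R f))).1 =ᵐ[T.μ] -((s * Complex.I) • (R f).1 : Lp Ell2 2 T.μ) := by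
    rw [h2]; exact Lp.coeFn_neg _
  filter_upwards [h3, Lp.coeFn_smul (s * Complex.I) (R f).1, T.opS_opZ_apply k (R f)]
    with x h3 h4 h5 h6
  rw [h5, Pi.neg_apply, h4, show x k = a + 1 from h6, sign_add_one, ← hs, Pi.smul_apply,
    neg_mul, neg_neg, eq_neg_iff_add_eq_zero, ← two_smul ℂ, smul_smul, smul_eq_zero] at h3
  exact h3.resolve_left (by simp [hss])

theorem reflects_coordinate
    (hS : ∀ k f, R (T.opS k (T.opZ k f)) = T.opS k (T.opZ k (R f))) (k : Idx m) (a : ZMod 2) :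
    Reflects R {x | x k = a} := by
  have h2 : ∀ b : ZMod 2, b + 1 = a ↔ b = a + 1 := by revert a; decide
  have h3 : ∀ b : ZMod 2, b + 1 + 1 = b := by decide
  have e : reflSet {x : Occ m | x k = a} = {x | x k = a + 1} := by
    ext x
    exact h2 (x k)
  rw [Reflects, e]
  refine ⟨fun f hf => vanishesOn_map_coordinate hS k a hf, fun f hf => ?_⟩
  have := vanishesOn_map_coordinate hS k (a + 1) hf
  rwa [h3] at this

theorem reflects_of_measurableSet (hR : ∀ f, R (R f) = f)
    (hS : ∀ k f, R (T.opS k (T.opZ k f)) = T.opS k (T.opZ k (R f))) {E : Set (Occ m)}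
    (hE : MeasurableSet E) : Reflects R E := by
  -- The sets reflected by `R` form a σ-algebra; since it contains the coordinate sets, it is
  -- everything.
  let M : MeasurableSpace (Occ m) :=
    { MeasurableSet' := fun E => MeasurableSet E ∧ Reflects R E
      measurableSet_empty := by
        refine ⟨.empty, fun f _ => ?_, fun f _ => ?_⟩ <;> exact .of_forall fun x hx => hx.elim
      measurableSet_compl := fun E h => ⟨h.1.compl, h.2.compl hR h.1⟩
      measurableSet_iUnion := fun E h => ⟨.iUnion fun n => (h n).1, .iUnion fun n => (h n).2⟩ }
  have hM : MeasurableSpace.pi ≤ M := by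
    refine iSup_le fun k => ?_
    refine measurable_iff_comap_le.1 (measurable_to_countable' fun a => ?_)
    exact ⟨measurable_pi_apply k (measurableSet_singleton a), reflects_coordinate hS k a⟩
  exact (hM E hE).2

/-- Split `f` into its parts on `E` and `Eᶜ`: their images are supported in `1 - E` and in its
complement, so they are the corresponding parts of `Rf`. -/
theorem map_cut (hR : ∀ f, R (R f) = f)
    (hS : ∀ k f, R (T.opS k (T.opZ k f)) = T.opS k (T.opZ k (R f))) {E : Set (Occ m)}
    (hE : MeasurableSet E) (f : T.Space) :
    R (T.cut E hE f) = T.cut (reflSet E) (measurableSet_reflSet hE) (R f) := by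
  have h1 : VanishesOn (R (T.cut E hE f)) (reflSet Eᶜ) :=
    (reflects_of_measurableSet hR hS hE.compl).1 _ (vanishesOn_cut E hE f)
  have h2 : VanishesOn (R (T.cut Eᶜ hE.compl f)) (reflSet E) :=
    (reflects_of_measurableSet hR hS hE).1 _ (by simpa using vanishesOn_cut Eᶜ hE.compl f)
  have h3 : (R f).1 =ᵐ[T.μ] (R (T.cut E hE f)).1 + (R (T.cut Eᶜ hE.compl f)).1 := by
    conv_lhs => rw [← T.cut_add_cut_compl E hE f, map_add]
    exact Lp.coeFn_add _ _
  refine Subtype.ext (Lp.ext ?_)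
  refine .trans ?_ (T.cut_apply _ _ _).symm
  filter_upwards [h1, h2, h3] with x h1 h2 h3
  by_cases h : x ∈ reflSet E
  · rw [Set.indicator_of_mem h, h3, Pi.add_apply, h2 h, add_zero]
  · rw [Set.indicator_of_notMem h, h1 h]

end Triple

/-! ### The fibres -/

/-- The standard basis vectors of `ℓ²`. -/
def stdBasis (i : ℕ) : Ell2 := lp.single 2 i (1 : ℂ)

theorem inner_stdBasis (i : ℕ) (v : Ell2) : inner ℂ (stdBasis i) v = v i := by
  rw [stdBasis, lp.inner_single_left]
  simp

theorem stdBasis_apply (i j : ℕ) : stdBasis i j = if i = j then 1 else 0 := by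
  rw [stdBasis, lp.single_apply]
  by_cases h : i = j
  · subst h; simp
  · rw [if_neg h, Pi.single_eq_of_ne (Ne.symm h)]

theorem norm_stdBasis (i : ℕ) : ‖stdBasis i‖ = 1 := by
  rw [stdBasis, lp.norm_single (by norm_num)]
  simp

theorem stdBasis_mem_fiber {i : ℕ} {n : ℕ∞} (h : (i : ℕ∞) < n) : stdBasis i ∈ fiber n := by
  intro j hj
  rw [stdBasis_apply, if_neg]
  rintro rfl
  exact absurd hj h.not_ge

theorem hasSum_stdBasis (v : Ell2) : HasSum (fun i => v i • stdBasis i) v := by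
  refine (lp.hasSum_single ENNReal.ofNat_ne_top v).congr_fun fun i => ?_
  rw [stdBasis, ← lp.single_smul, smul_eq_mul, mul_one]

/-- Continuous semilinear maps that agree on the basis vectors of a fibre agree on the fibre. -/
theorem eq_on_fiber {σ : ℂ →+* ℂ} {F G : Ell2 →SL[σ] Ell2} {n : ℕ∞}
    (h : ∀ i : ℕ, (i : ℕ∞) < n → F (stdBasis i) = G (stdBasis i)) {v : Ell2} (hv : v ∈ fiber n) :
    F v = G v := by
  refine ((hasSum_stdBasis v).mapL F).unique ?_
  refine ((hasSum_stdBasis v).mapL G).congr_fun fun i => ?_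
  rw [ContinuousLinearMap.map_smulₛₗ, ContinuousLinearMap.map_smulₛₗ]
  by_cases hi : (i : ℕ∞) < n
  · rw [h i hi]
  · rw [hv i (not_lt.1 hi), map_zero, zero_smul, zero_smul]

/-- A fibre that contains `n` orthonormal vectors has dimension at least `n`. -/
theorem le_of_orthonormal_mem_fiber {n k : ℕ∞} {u : ℕ → Ell2}
    (hu : ∀ i j : ℕ, (i : ℕ∞) < n → (j : ℕ∞) < n →
      inner ℂ (u i) (u j) = if i = j then (1 : ℂ) else 0)
    (hmem : ∀ i : ℕ, (i : ℕ∞) < n → u i ∈ fiber k) : n ≤ k := by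
  -- Testing against finite `a ≤ n` reduces the possibly infinite `n` to a finite dimension count.
  refine ENat.forall_natCast_le_iff_le.1 fun a ha => ?_
  induction k with
  | top => exact le_top
  | coe k =>
    have hlt : ∀ i : Fin a, ((i : ℕ) : ℕ∞) < n := fun i =>
      lt_of_lt_of_le (Nat.cast_lt.2 i.2) ha
    have ho : Orthonormal ℂ (fun i : Fin a => u i) := by
      rw [orthonormal_iff_ite]
      intro i j
      rw [hu i j (hlt i) (hlt j)]
      simp [Fin.ext_iff]
    let L : fiber k →ₗ[ℂ] (Fin k → ℂ) :=
      { toFun := fun v i => (v : Ell2) i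
        map_add' := fun v w => rfl
        map_smul' := fun c v => rfl }
    have hL : LinearMap.ker L = ⊥ := by
      rw [LinearMap.ker_eq_bot']
      intro v hv
      refine Subtype.ext (lp.ext (funext fun i => ?_))
      by_cases hi : i < k
      · exact congrFun hv ⟨i, hi⟩
      · exact v.2 i (Nat.cast_le.2 (not_lt.1 hi))
    have hli : LinearIndependent ℂ (fun i : Fin a => (⟨u i, hmem i (hlt i)⟩ : fiber k)) :=
      LinearIndependent.of_comp (fiber k).subtype ho.linearIndependent
    have := (hli.map' L hL).fintype_card_le_finrank
    simpa using this

theorem hasSum_norm_sq (v : Ell2) : HasSum (fun i => ‖v i‖ ^ 2) (‖v‖ ^ 2) := by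
  have := (lp.hasSum_inner (𝕜 := ℂ) v v).mapL RCLike.reCLM
  simp only [RCLike.reCLM_apply, inner_self_eq_norm_sq] at this
  exact this

/-- The antilinear operator that maps the standard basis to a given orthogonal family of vectors
of norm at most `1`. -/
theorem exists_conjLinear_of_orthogonal {u : ℕ → Ell2}
    (hu : ∀ i j, i ≠ j → inner ℂ (u i) (u j) = (0 : ℂ)) (hu1 : ∀ i, ‖u i‖ ≤ 1) :
    ∃ A : Ell2 →L⋆[ℂ] Ell2, (∀ v, HasSum (fun i => conj (v i) • u i) (A v)) ∧
      ∀ v, (∀ i, v i ≠ 0 → ‖u i‖ = 1) → ‖A v‖ = ‖v‖ := by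
  have hof : OrthogonalFamily ℂ (fun i => Submodule.span ℂ {u i})
      (fun i => (Submodule.span ℂ {u i}).subtypeₗᵢ) := by
    intro i j hij v w
    obtain ⟨a, ha⟩ := Submodule.mem_span_singleton.1 v.2
    obtain ⟨b, hb⟩ := Submodule.mem_span_singleton.1 w.2
    simp [← ha, ← hb, inner_smul_left, inner_smul_right, hu i j hij]
  let g : Ell2 → ∀ i, Submodule.span ℂ {u i} := fun v i =>
    conj (v i) • ⟨u i, Submodule.mem_span_singleton_self _⟩
  have hg : ∀ v i, ‖g v i‖ = ‖v i‖ * ‖u i‖ := fun v i => by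
    simp [g, norm_smul]
  have hle : ∀ v i, ‖g v i‖ ^ 2 ≤ ‖v i‖ ^ 2 := fun v i => by
    rw [hg]
    have := mul_le_of_le_one_right (norm_nonneg (v i)) (hu1 i)
    gcongr
  have hgs : ∀ v, Summable fun i => ‖g v i‖ ^ 2 := fun v =>
    (hasSum_norm_sq v).summable.of_nonneg_of_le (fun i => by positivity) (hle v)
  have hs : ∀ v : Ell2, Summable fun i => conj (v i) • u i := fun v =>
    (hof.summable_iff_norm_sq_summable (g v)).2 (hgs v)
  have hn : ∀ v : Ell2, HasSum (fun i => ‖g v i‖ ^ 2) (‖∑' i, conj (v i) • u i‖ ^ 2) := by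
    intro v
    have h1 := ((hs v).hasSum.norm).pow 2
    refine h1.congr fun s => ?_
    exact hof.norm_sum (g v) s
  let A : Ell2 →L⋆[ℂ] Ell2 := LinearMap.mkContinuous
    { toFun := fun v => ∑' i, conj (v i) • u i
      map_add' := fun v w => by
        rw [← (hs v).tsum_add (hs w)]
        simp [add_smul]
      map_smul' := fun a v => by
        rw [← (hs v).tsum_const_smul]
        simp [mul_smul] } 1 fun v => by
      rw [one_mul]
      exact (pow_le_pow_iff_left₀ (norm_nonneg _) (norm_nonneg _) two_ne_zero).1
        (hasSum_le (hle v) (hn v) (hasSum_norm_sq v))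
  refine ⟨A, fun v => (hs v).hasSum, fun v hv => ?_⟩
  refine (pow_left_inj₀ (norm_nonneg _) (norm_nonneg _) two_ne_zero).1 ((hn v).unique ?_)
  refine (hasSum_norm_sq v).congr_fun fun i => ?_
  rw [hg]
  by_cases h : v i = 0
  · simp [h]
  · rw [hv i h, mul_one]

/-! ### Reconstruction of the fibre maps from the involution. -/

namespace Triple

variable (T : Triple m)

/-- The measure may be infinite, so constant sections need not be square integrable; a strictly
positive weight repairs this and can be divided out pointwise. -/
theorem exists_weight : ∃ w : Occ m → ℝ, Measurable w ∧ (∀ x, 0 < w x) ∧ MemLp w 2 T.μ := by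
  obtain ⟨g, hg, hgm, hgi⟩ := exists_pos_lintegral_lt_of_sigmaFinite T.μ one_ne_zero
  refine ⟨fun x => Real.sqrt (g x), by fun_prop, fun x => Real.sqrt_pos.2 (hg x),
    (by fun_prop : Measurable fun x => Real.sqrt (g x)).aestronglyMeasurable, ?_⟩
  rw [eLpNorm_lt_top_iff_lintegral_rpow_enorm_lt_top two_ne_zero ENNReal.ofNat_ne_top]
  refine lt_of_eq_of_lt ?_ (hgi.trans ENNReal.one_lt_top)
  refine lintegral_congr fun x => ?_
  rw [ENNReal.toReal_ofNat, ENNReal.rpow_ofNat, Real.enorm_of_nonneg (Real.sqrt_nonneg _),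
    ← ENNReal.ofReal_pow (Real.sqrt_nonneg _), Real.sq_sqrt (g x).coe_nonneg, ENNReal.ofReal_coe_nnreal]

/-- Sections of the direct integral that span the fibres. -/
theorem exists_sections {w : Occ m → ℝ} (hw : MemLp w 2 T.μ) :
    ∃ s : ℕ → T.Space, ∀ i : ℕ, (s i).1 =ᵐ[T.μ]
      fun x => if (i : ℕ∞) < T.ν x then (w x : ℂ) • stdBasis i else 0 := by
  have hmeas : ∀ i : ℕ, MeasurableSet {x | (i : ℕ∞) < T.ν x} := fun i =>
    T.measurable_ν (MeasurableSet.of_discrete (s := Set.Ioi (i : ℕ∞)))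
  have hL : ∀ i : ℕ, MemLp (fun x => if (i : ℕ∞) < T.ν x then (w x : ℂ) • stdBasis i else 0)
      2 T.μ := fun i => by
    have h1 : MemLp (fun x => (w x : ℂ) • stdBasis i) 2 T.μ := by
      refine hw.of_le ?_ (.of_forall fun x => ?_)
      · exact (Complex.continuous_ofReal.comp_aestronglyMeasurable hw.1).smul_const _
      · rw [norm_smul, norm_stdBasis, mul_one, Complex.norm_real]
    exact (memLp_congr_ae (.of_forall fun x => by simp [Set.indicator_apply])).1
      (h1.indicator (hmeas i))
  refine ⟨fun i => ⟨(hL i).toLp _, ?_⟩, fun i => (hL i).coeFn_toLp⟩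
  filter_upwards [(hL i).coeFn_toLp] with x hx
  rw [hx]
  split_ifs with h
  · exact Submodule.smul_mem _ _ (stdBasis_mem_fiber h)
  · exact zero_mem _

variable {T} {R : T.Space →ₛₗᵢ[starRingEnd ℂ] T.Space}

/-- If `E` is null, then every section vanishes on `E`, in particular `R s₀`; so `s₀ = R R s₀`
vanishes on `1 - E`. But `s₀` is nonzero almost everywhere, so `1 - E` is null. -/
theorem map_reflect_absolutelyContinuous (hR : ∀ f, R (R f) = f)
    (hS : ∀ k f, R (T.opS k (T.opZ k f)) = T.opS k (T.opZ k (R f))) :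
    T.μ.map (· + 1) ≪ T.μ := by
  refine Measure.AbsolutelyContinuous.mk fun E hE h0 => ?_
  obtain ⟨w, -, hw, hwL⟩ := T.exists_weight
  obtain ⟨s, hs⟩ := T.exists_sections hwL
  rw [Measure.map_apply (measurable_add_const 1) hE]
  have h1 : VanishesOn (R (s 0)) E := by
    filter_upwards [measure_eq_zero_iff_ae_notMem.1 h0] with x hx h
    exact absurd h hx
  have h2 := (reflects_of_measurableSet hR hS hE).1 _ h1
  rw [hR] at h2
  rw [measure_eq_zero_iff_ae_notMem]
  filter_upwards [h2, hs 0] with x h2 h3 h4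
  have h5 := h3.symm.trans (h2 h4)
  -- Fibres are nonzero, so the section `s₀` is not cut off at any point.
  have h6 : ((0 : ℕ) : ℕ∞) < T.ν x := lt_of_lt_of_le (by simp) (T.one_le_ν x)
  rw [if_pos h6, smul_eq_zero, Complex.ofReal_eq_zero, ← norm_eq_zero (a := stdBasis 0),
    norm_stdBasis] at h5
  exact h5.elim (hw x).ne' one_ne_zero

/-- The pointwise form of the antiunitarity of `R`. -/
theorem inner_map_map_ae (hR : ∀ f, R (R f) = f)
    (hS : ∀ k f, R (T.opS k (T.opZ k f)) = T.opS k (T.opZ k (R f))) (f g : T.Space) :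
    ∀ᵐ x ∂T.μ, inner ℂ ((R f).1 x) ((R g).1 x)
      = (T.density 1 x).toReal • conj (inner ℂ (f.1 (x + 1)) (g.1 (x + 1)) : ℂ) := by
  have hac := map_reflect_absolutelyContinuous hR hS
  have hint : Integrable (fun x => conj (inner ℂ (f.1 (x + 1)) (g.1 (x + 1)) : ℂ))
      (T.μ.map (· + 1)) := by
    refine (integrable_map_equiv (translate 1) _).2 ?_
    have h := (Complex.conjLIE.toContinuousLinearEquiv.toContinuousLinearMap).integrable_comp
      (L2.integrable_inner (𝕜 := ℂ) f.1 g.1)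
    refine h.congr (.of_forall fun x => ?_)
    change _ = conj (inner ℂ (f.1 (x + 1 + 1)) (g.1 (x + 1 + 1)) : ℂ)
    rw [Occ.add_add_cancel]
    rfl
  refine Integrable.ae_eq_of_forall_setIntegral_eq _ _ (L2.integrable_inner (R f).1 (R g).1)
    ((integrable_rnDeriv_smul_iff hac).2 hint) fun E hE _ => ?_
  have hE' := measurableSet_reflSet hE
  -- Cutting `f` to `1 - E` makes `R` produce a cut to `E`, so the global identity becomes one
  -- between integrals over `E` and over `1 - E`.
  have h1 := inner_conjIsometry R (T.cut _ hE' f) g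
  rw [map_cut hR hS, inner_cut_left, inner_cut_left, reflSet_reflSet] at h1
  rw [h1]
  refine .trans ?_ (setIntegral_rnDeriv_smul hac hE).symm
  refine .trans ?_ ((translate 1).measurableEmbedding.setIntegral_map _ _).symm
  rw [← integral_conj]
  refine integral_congr_ae (.of_forall fun x => ?_)
  change _ = conj (inner ℂ (f.1 (x + 1 + 1)) (g.1 (x + 1 + 1)) : ℂ)
  rw [Occ.add_add_cancel]

end Triple

/-- Termwise pairing in the manner of Parseval. It will be used with `a = r(x) v` and `y = (Rf)(x)`,
for which only the products with the `u_i` are known. -/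
theorem inner_hasSum_conj {u : ℕ → Ell2} {v a y : Ell2} {q : ℝ}
    (ha : HasSum (fun i => conj (v i) • u i) a)
    (hy : ∀ i, inner ℂ (u i) y = (q : ℂ) * conj (v i)) :
    inner ℂ a y = ((q * ‖v‖ ^ 2 : ℝ) : ℂ) := by
  have h1 := (ha.mapL (innerSL ℂ y)).map (starRingEnd ℂ) Complex.continuous_conj
  have h2 := Complex.hasSum_ofReal.2 ((hasSum_norm_sq v).mul_left q)
  rw [← inner_conj_symm]
  refine h1.unique (h2.congr_fun fun i => ?_)
  have h3 : conj (inner ℂ y (u i)) = (q : ℂ) * conj (v i) := by rw [inner_conj_symm, hy]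
  change conj (inner ℂ y (conj (v i) • u i)) = _
  rw [inner_smul_right, map_mul, h3, Complex.conj_conj, mul_left_comm, Complex.mul_conj']
  push_cast
  rfl

namespace Triple

variable {T : Triple m} {R : T.Space →ₛₗᵢ[starRingEnd ℂ] T.Space}

theorem density_toReal_pos {δ : Occ m} (hδ : T.μ.map (· + δ) ≪ T.μ) :
    ∀ᵐ x ∂T.μ, 0 < (T.density δ x).toReal := by
  filter_upwards [T.density_mul_translate_self hδ, T.density_lt_top δ] with x h1 h2
  exact ENNReal.toReal_pos (left_ne_zero_of_mul (h1 ▸ one_ne_zero)) h2.ne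

/-- The fields of orthonormal vectors `u_i(x)` that will be the images of the basis vectors. -/
theorem exists_orthonormal_fields (hR : ∀ f, R (R f) = f)
    (hS : ∀ k f, R (T.opS k (T.opZ k f)) = T.opS k (T.opZ k (R f))) :
    ∃ u : ℕ → Occ m → Ell2, (∀ i, StronglyMeasurable (u i)) ∧
      (∀ᵐ x ∂T.μ, ∀ i j : ℕ, inner ℂ (u i x) (u j x)
        = if i = j ∧ (i : ℕ∞) < T.ν (x + 1) then (1 : ℂ) else 0) ∧
      (∀ᵐ x ∂T.μ, ∀ i : ℕ, u i x ∈ fiber (T.ν x)) ∧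
      ∀ f : T.Space, ∀ᵐ x ∂T.μ, ∀ i : ℕ, inner ℂ (u i x) ((R f).1 x)
        = (Real.sqrt (T.density 1 x).toReal : ℂ) * conj (f.1 (x + 1) i) := by
  obtain ⟨w, hwm, hw, hwL⟩ := T.exists_weight
  obtain ⟨s, hs⟩ := T.exists_sections hwL
  have hac := map_reflect_absolutelyContinuous hR hS
  have hq : Measure.QuasiMeasurePreserving (· + 1) T.μ T.μ := ⟨measurable_add_const 1, hac⟩
  have hs' : ∀ᵐ x ∂T.μ, ∀ i : ℕ, (s i).1 (x + 1)
      = if (i : ℕ∞) < T.ν (x + 1) then (w (x + 1) : ℂ) • stdBasis i else 0 :=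
    ae_all_iff.2 fun i => hq.ae (hs i)
  -- The expected formula gives `(R s_i)(x) = √(dμ(1 - x)/dμ(x)) w(1 - x) r(x) e_i`, so this factor
  -- normalizes it to `r(x) e_i`.
  let c : Occ m → ℝ := fun x => (w (x + 1) * Real.sqrt (T.density 1 x).toReal)⁻¹
  let u : ℕ → Occ m → Ell2 := fun i x => (c x : ℂ) • (R (s i)).1 x
  have hc : Measurable fun x => (c x : ℂ) := by
    have hd : Measurable (T.density 1) := Measure.measurable_rnDeriv _ _
    have h1 : Measurable fun x => w (x + 1) := hwm.comp (measurable_add_const 1)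
    fun_prop
  have huf : ∀ f : T.Space, ∀ᵐ x ∂T.μ, ∀ i : ℕ, inner ℂ (u i x) ((R f).1 x)
      = (Real.sqrt (T.density 1 x).toReal : ℂ) * conj (f.1 (x + 1) i) := by
    intro f
    have h0 : ∀ᵐ x ∂T.μ, ∀ i : ℕ, inner ℂ ((R (s i)).1 x) ((R f).1 x)
        = (T.density 1 x).toReal • conj (inner ℂ ((s i).1 (x + 1)) (f.1 (x + 1)) : ℂ) :=
      ae_all_iff.2 fun i => inner_map_map_ae hR hS (s i) f
    filter_upwards [h0, hs', density_toReal_pos hac, hq.ae f.2] with x h0 h1 h2 h3 i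
    have h4 : inner ℂ ((s i).1 (x + 1)) (f.1 (x + 1)) = (w (x + 1) : ℂ) * f.1 (x + 1) i := by
      rw [h1 i]
      split_ifs with h
      · rw [inner_smul_left, Complex.conj_ofReal, inner_stdBasis]
      -- Beyond the dimension of the fibre both sides are zero, so the formula holds for every `i`.
      · rw [h3 i (not_lt.1 h), inner_zero_left, mul_zero]
    have h5 : c x * (T.density 1 x).toReal * w (x + 1) = Real.sqrt (T.density 1 x).toReal := by
      have e := Real.mul_self_sqrt h2.le
      have h6 := (Real.sqrt_pos.2 h2).ne'
      have h7 := (hw (x + 1)).ne'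
      calc (w (x + 1) * Real.sqrt (T.density 1 x).toReal)⁻¹ * (T.density 1 x).toReal * w (x + 1)
          = (w (x + 1) * Real.sqrt (T.density 1 x).toReal)⁻¹ *
            (Real.sqrt (T.density 1 x).toReal * Real.sqrt (T.density 1 x).toReal) * w (x + 1) := by
            rw [e]
        _ = Real.sqrt (T.density 1 x).toReal := by field_simp
    change inner ℂ ((c x : ℂ) • (R (s i)).1 x) _ = _
    rw [inner_smul_left, h0, h4, Complex.conj_ofReal, map_mul, Complex.conj_ofReal, ← h5,
      Complex.real_smul]
    push_cast
    ring
  refine ⟨u, fun i => hc.stronglyMeasurable.smul (Lp.stronglyMeasurable _), ?_, ?_, huf⟩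
  · have h0 : ∀ᵐ x ∂T.μ, ∀ j i : ℕ, inner ℂ (u i x) ((R (s j)).1 x)
        = (Real.sqrt (T.density 1 x).toReal : ℂ) * conj ((s j).1 (x + 1) i) :=
      ae_all_iff.2 fun j => huf (s j)
    filter_upwards [h0, hs', density_toReal_pos hac] with x h0 h1 h2 i j
    change inner ℂ (u i x) ((c x : ℂ) • (R (s j)).1 x) = _
    rw [inner_smul_right, h0, h1]
    have h5 : (c x : ℂ) * ((Real.sqrt (T.density 1 x).toReal : ℂ) * (w (x + 1) : ℂ)) = 1 := by
      rw [← Complex.ofReal_mul, ← Complex.ofReal_mul, mul_comm _ (w (x + 1)),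
        inv_mul_cancel₀ (mul_pos (hw _) (Real.sqrt_pos.2 h2)).ne', Complex.ofReal_one]
    by_cases hj : (j : ℕ∞) < T.ν (x + 1)
    · rw [if_pos hj, lp.coeFn_smul, Pi.smul_apply, stdBasis_apply]
      by_cases hij : i = j
      · subst hij
        rw [if_pos rfl, if_pos ⟨rfl, hj⟩, smul_eq_mul, mul_one, Complex.conj_ofReal, h5]
      · rw [if_neg (Ne.symm hij), if_neg fun h => hij h.1, smul_zero, map_zero, mul_zero, mul_zero]
    · rw [if_neg hj, if_neg (fun h : i = j ∧ _ => hj (h.1 ▸ h.2))]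
      simp
  · refine ae_all_iff.2 fun i => ?_
    filter_upwards [(R (s i)).2] with x hx
    exact Submodule.smul_mem _ _ hx

/-- An antilinear isometric involution that commutes with the operators `J_{σ(z_k)} J_{z_k}` has
the form `f ↦ √(dμ(1 - x)/dμ(x)) r(x) f(1 - x)`. -/
theorem exists_isReflection (hR : ∀ f, R (R f) = f)
    (hS : ∀ k f, R (T.opS k (T.opZ k f)) = T.opS k (T.opZ k (R f))) :
    ∃ r, T.IsReflection r ∧ ∀ f, (R f).1 =ᵐ[T.μ] T.reflFun r f.1 := by
  obtain ⟨u, hum, huu, hmem, huR⟩ := exists_orthonormal_fields hR hS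
  have hac := map_reflect_absolutelyContinuous hR hS
  have hq : Measure.QuasiMeasurePreserving (· + 1) T.μ T.μ := ⟨measurable_add_const 1, hac⟩
  have hνle : ∀ᵐ x ∂T.μ, T.ν (x + 1) ≤ T.ν x := by
    filter_upwards [huu, hmem] with x h1 h2
    refine le_of_orthonormal_mem_fiber (u := fun i => u i x) (fun i j hi _ => ?_)
      fun i _ => h2 i
    rw [h1]
    simp [hi]
  have hν : ∀ᵐ x ∂T.μ, T.ν (x + 1) = T.ν x := by
    -- The inequality at `1 - x` is the reverse inequality at `x`.
    filter_upwards [hνle, hq.ae hνle] with x h1 h2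
    rw [Occ.add_add_cancel] at h2
    exact le_antisymm h1 h2
  -- Strong measurability of `r` is required everywhere, while the fields are orthogonal only almost
  -- everywhere. On the measurable set `G` the operator is a limit of explicit partial sums; off `G`
  -- it is set to zero.
  let G : Set (Occ m) := {x | (∀ i j, i ≠ j → inner ℂ (u i x) (u j x) = (0 : ℂ)) ∧
    ∀ i, ‖u i x‖ ≤ 1}
  have hGm : MeasurableSet G := by
    have e : G = (⋂ i, ⋂ j, ⋂ _ : i ≠ j, {x | inner ℂ (u i x) (u j x) = (0 : ℂ)}) ∩
        ⋂ i, {x | ‖u i x‖ ≤ 1} := by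
      ext x
      simp [G]
    rw [e]
    refine .inter (.iInter fun i => .iInter fun j => .iInter fun _ => ?_) (.iInter fun i => ?_)
    · exact measurableSet_eq_fun ((hum i).inner (hum j)).measurable measurable_const
    · exact measurableSet_le (hum i).norm.measurable measurable_const
  have hnorm : ∀ᵐ x ∂T.μ, ∀ i : ℕ, ‖u i x‖ = if (i : ℕ∞) < T.ν x then 1 else 0 := by
    filter_upwards [huu, hν] with x h1 h2 i
    have h3 := inner_self_eq_norm_sq (𝕜 := ℂ) (u i x)
    rw [h1 i i, h2] at h3
    split_ifs with h
    · rw [if_pos ⟨rfl, h⟩, RCLike.one_re] at h3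
      exact (pow_eq_one_iff_of_nonneg (norm_nonneg _) two_ne_zero).1 h3.symm
    · rw [if_neg fun h' => h h'.2, map_zero] at h3
      exact sq_eq_zero_iff.1 h3.symm
  have hG : ∀ᵐ x ∂T.μ, x ∈ G := by
    filter_upwards [huu, hnorm] with x h1 h2
    refine ⟨fun i j hij => by rw [h1, if_neg fun h => hij h.1], fun i => ?_⟩
    rw [h2]
    split_ifs <;> simp
  have hex : ∀ x, ∃ A : Ell2 →L⋆[ℂ] Ell2,
      (x ∈ G → (∀ v, HasSum (fun i => conj (v i) • u i x) (A v)) ∧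
        ∀ v, (∀ i, v i ≠ 0 → ‖u i x‖ = 1) → ‖A v‖ = ‖v‖) ∧ (x ∉ G → A = 0) := by
    intro x
    by_cases h : x ∈ G
    · obtain ⟨A, hA⟩ := exists_conjLinear_of_orthogonal h.1 h.2
      exact ⟨A, fun _ => hA, fun h' => absurd h h'⟩
    · exact ⟨0, fun h' => absurd h' h, fun _ => rfl⟩
  choose r hr hr0 using hex
  have hisom : ∀ᵐ x ∂T.μ, ∀ v ∈ fiber (T.ν x), r x v ∈ fiber (T.ν x) ∧ ‖r x v‖ = ‖v‖ := by
    filter_upwards [hG, hnorm, hmem] with x h1 h2 h3 v hv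
    refine ⟨(isClosed_fiber _).mem_of_tendsto ((hr x h1).1 v) (.of_forall fun s =>
      Submodule.sum_mem _ fun i _ => Submodule.smul_mem _ _ (h3 i)), (hr x h1).2 v fun i hi => ?_⟩
    rw [h2, if_pos]
    by_contra h
    exact hi (hv i (not_lt.1 h))
  have href : T.IsReflection r := by
    refine ⟨hac, hν, fun v => ?_, hisom⟩
    refine stronglyMeasurable_of_tendsto Filter.atTop
      (f := fun n => G.indicator fun x => ∑ i ∈ Finset.range n, conj (v i) • u i x) ?_ ?_
    · intro n
      exact (Finset.stronglyMeasurable_fun_sum (Finset.range n) fun i _ =>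
        (hum i).fun_const_smul (conj (v i))).indicator hGm
    · rw [tendsto_pi_nhds]
      intro x
      by_cases h : x ∈ G
      · simpa [h] using ((hr x h).1 v).tendsto_sum_nat
      · simp [h, hr0 x h]
  refine ⟨r, href, fun f => ?_⟩
  filter_upwards [hG, huR f, hisom, inner_map_map_ae hR hS f f, href.reflect_mem_fiber f.2]
    with x h1 h2 h3 h4 h5
  set d := (T.density 1 x).toReal with hd
  have hd0 : 0 ≤ d := ENNReal.toReal_nonneg
  set v := f.1 (x + 1) with hv
  -- Equality in Cauchy–Schwarz: the two vectors have the same norm squared, and it equals their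
  -- inner product, so they coincide. This avoids proving that the `u_i` span the fibre.
  have e1 : ‖(R f).1 x‖ ^ 2 = d * ‖v‖ ^ 2 := by
    have e := congrArg Complex.re h4
    rw [Complex.real_smul, Complex.re_ofReal_mul, Complex.conj_re] at e
    rw [← inner_self_eq_norm_sq (𝕜 := ℂ), ← inner_self_eq_norm_sq (𝕜 := ℂ)]
    exact e
  have e2 := inner_hasSum_conj ((hr x h1).1 v) h2
  have e3 : ‖T.reflFun r f.1 x‖ ^ 2 = d * ‖v‖ ^ 2 := by
    rw [reflFun, norm_smul, (h3 v h5).2, mul_pow, Complex.norm_real, Real.norm_eq_abs, sq_abs,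
      Real.sq_sqrt hd0]
  have e4 : inner ℂ (T.reflFun r f.1 x) ((R f).1 x) = ((d * ‖v‖ ^ 2 : ℝ) : ℂ) := by
    rw [reflFun, inner_smul_left, Complex.conj_ofReal, e2, ← Complex.ofReal_mul, ← mul_assoc,
      Real.mul_self_sqrt hd0]
  symm
  rw [← sub_eq_zero, ← norm_eq_zero, ← sq_eq_zero_iff, @norm_sub_sq ℂ, e1, e3, e4]
  simp only [RCLike.re_to_complex, Complex.ofReal_re]
  ring

end Triple

/-! ### Algebraic relations for the fibre maps. -/

namespace Triple

variable {T : Triple m} {R : T.Space →ₛₗᵢ[starRingEnd ℂ] T.Space}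
  {r : Occ m → (Ell2 →L⋆[ℂ] Ell2)}

namespace IsReflection

/-- Evaluating `R² = 1` on the countably many sections `s_i` gives a single null set; the densities
multiply to `1`, and continuity extends the identity from basis vectors to the fibre. -/
theorem apply_apply_of_involution (h : T.IsReflection r)
    (hRr : ∀ f, (R f).1 =ᵐ[T.μ] T.reflFun r f.1) (hR : ∀ f, R (R f) = f) :
    ∀ᵐ x ∂T.μ, ∀ v ∈ fiber (T.ν x), r x (r (x + 1) v) = v := by
  obtain ⟨w, -, hw, hwL⟩ := T.exists_weight
  obtain ⟨s, hs⟩ := T.exists_sections hwL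
  have h0 : ∀ i, (s i).1 =ᵐ[T.μ] T.reflFun r (T.reflFun r (s i).1) := fun i => by
    conv_lhs => rw [← hR (s i)]
    exact (hRr _).trans (h.reflFun_congr (hRr _))
  filter_upwards [ae_all_iff.2 hs, ae_all_iff.2 h0, T.density_mul_translate_self h.ac]
    with x h1 h2 h3 v hv
  refine eq_on_fiber (F := (r x).comp (r (x + 1))) (G := .id ℂ Ell2) (fun i hi => ?_) hv
  have h4 := h2 i
  have h5 : (w x : ℂ) ≠ 0 := Complex.ofReal_ne_zero.2 (hw x).ne'
  rw [reflFun_reflFun, h3, h1, if_pos hi, ContinuousLinearMap.map_smulₛₗ,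
    ContinuousLinearMap.map_smulₛₗ, Complex.conj_conj, ENNReal.toReal_one, Real.sqrt_one,
    Complex.ofReal_one, one_smul] at h4
  exact (smul_right_injective _ h5 h4).symm

/-- Both orders of composition evaluate the section at `1 - (x + δ_k)` with the same density.
Cancelling phase, density and weight leaves the relation on basis vectors. -/
theorem apply_c_of_commute (h : T.IsReflection r)
    (hRr : ∀ f, (R f).1 =ᵐ[T.μ] T.reflFun r f.1) (k : Idx m)
    (hZ : ∀ f, R (T.opZ k f) = T.opZ k (R f)) :
    ∀ᵐ x ∂T.μ, ∀ v ∈ fiber (T.ν x),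
      r x (T.c k (x + 1) v) = (-1 : ℂ) ^ (k : ℕ) • T.c k x (r (x + delta k) v) := by
  obtain ⟨w, -, hw, hwL⟩ := T.exists_weight
  obtain ⟨s, hs⟩ := T.exists_sections hwL
  have hop : ∀ f : T.Space, (T.opZ k f).1 =ᵐ[T.μ] T.opFun (phaseZ k) k f.1 :=
    T.op_apply (phaseZ k) (measurable_phaseZ k) (norm_phaseZ k) k
  have h0 : ∀ i, T.reflFun r (T.opFun (phaseZ k) k (s i).1)
      =ᵐ[T.μ] T.opFun (phaseZ k) k (T.reflFun r (s i).1) := fun i => by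
    refine (h.reflFun_congr (hop _)).symm.trans ((hRr _).symm.trans ?_)
    rw [hZ]
    exact (hop _).trans (T.opFun_congr _ k (hRr _))
  have hδ := delta_mem k
  have hs' : ∀ᵐ x ∂T.μ, ∀ i : ℕ, (s i).1 (x + delta k + 1)
      = if (i : ℕ∞) < T.ν (x + delta k + 1) then (w (x + delta k + 1) : ℂ) • stdBasis i else 0 :=
    T.ae_translate hδ (h.qmp.ae (ae_all_iff.2 hs))
  filter_upwards [ae_all_iff.2 h0, hs', T.ae_translate hδ h.ν_eq, T.ν_invariant _ hδ,
    density_reflect_comm h.ac k, density_toReal_pos (T.quasiInvariant _ hδ).1,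
    T.ae_translate hδ (density_toReal_pos h.ac)] with x h1 h2 h3 h4 h5 h6 h7 v hv
  refine eq_on_fiber (F := (r x).comp (T.c k (x + 1)))
    (G := (-1 : ℂ) ^ (k : ℕ) • (T.c k x).comp (r (x + delta k))) (fun i hi => ?_) hv
  have h8 := h1 i
  have hw' : (w (x + delta k + 1) : ℂ) ≠ 0 := Complex.ofReal_ne_zero.2 (hw _).ne'
  have hp : phaseZ k x ≠ 0 := norm_ne_zero_iff.1 (by rw [norm_phaseZ]; exact one_ne_zero)
  have hq : (Real.sqrt (T.density (delta k) x * T.density 1 (x + delta k)).toReal : ℂ) ≠ 0 := by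
    rw [ENNReal.toReal_mul]
    exact Complex.ofReal_ne_zero.2 (Real.sqrt_pos.2 (mul_pos h6 h7)).ne'
  rw [reflFun_opFun, opFun_reflFun, h5, h2, h3, h4, if_pos hi, conj_phaseZ_add_one, map_smul,
    ContinuousLinearMap.map_smulₛₗ, ContinuousLinearMap.map_smulₛₗ, map_smul, Complex.conj_ofReal,
    smul_comm _ (w (x + delta k + 1) : ℂ), smul_comm _ (w (x + delta k + 1) : ℂ), mul_assoc,
    mul_comm ((-1 : ℂ) ^ (k : ℕ)), mul_smul] at h8
  have h9 := smul_right_injective _ (mul_ne_zero hp hq) (smul_right_injective _ hw' h8)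
  change r x (T.c k (x + 1) (stdBasis i))
    = (-1 : ℂ) ^ (k : ℕ) • T.c k x (r (x + delta k) (stdBasis i))
  -- The sign arrives on the other side of the equation; it is its own inverse.
  rw [← h9, smul_smul, ← mul_pow]
  simp

end IsReflection

/-- Reflection is an involution, so pushing the relation forward once more reverses it. -/
theorem absolutelyContinuous_map_reflect (h : T.μ.map (· + 1) ≪ T.μ) :
    T.μ ≪ T.μ.map (· + 1) := by
  have h1 := h.map (measurable_add_const (1 : Occ m))
  rw [Measure.map_map (measurable_add_const _) (measurable_add_const _)] at h1
  have h2 : (fun x : Occ m => x + 1) ∘ (· + 1) = id := funext fun x => Occ.add_add_cancel x 1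
  rwa [h2, Measure.map_id] at h1

/-- An invariant real form is given by a family `r` that intertwines the operators `c_k`. -/
theorem exists_isReflection_of_realForm {Z : Type*} [NormedAddCommGroup Z]
    [InnerProductSpace ℝ Z] (b : HilbertBasis (Idx m ⊕ Idx m) ℝ Z) {V : Submodule ℝ T.Space}
    (hV : IsInvariantRealForm (T.rep b) V) :
    ∃ r, T.IsReflection r ∧
      (∀ᵐ x ∂T.μ, ∀ v ∈ fiber (T.ν x), r x (r (x + 1) v) = v) ∧
      ∀ k : Idx m, ∀ᵐ x ∂T.μ, ∀ v ∈ fiber (T.ν x),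
        r x (T.c k (x + 1) v) = (-1 : ℂ) ^ (k : ℕ) • T.c k x (r (x + delta k) v) := by
  obtain ⟨R, hR, hRG⟩ := hV.exists_conjIsometry
  have hgen : ∀ p, ∀ v ∈ V, T.generator p v ∈ V := fun p v hv => by
    rw [← T.rep_ι_basis b]
    exact hV.invariant _ v hv
  have hZ : ∀ k f, R (T.opZ k f) = T.opZ k (R f) := fun k =>
    hRG (T.opZ k).toLinearMap (hgen (.inl k))
  have hS : ∀ k f, R (T.opS k f) = T.opS k (R f) := fun k =>
    hRG (T.opS k).toLinearMap (hgen (.inr k))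
  obtain ⟨r, hr, hRr⟩ := exists_isReflection hR fun k f => by rw [hS, hZ]
  exact ⟨r, hr, hr.apply_apply_of_involution hRr hR,
    fun k => hr.apply_c_of_commute hRr k (hZ k)⟩

end Triple

end GW

end

theorem theorem3p5 {m : ℕ∞} {Z : Type*} [NormedAddCommGroup Z] [InnerProductSpace ℝ Z]
    (b : HilbertBasis (GW.Idx m ⊕ GW.Idx m) ℝ Z) (T : GW.Triple m) :
    (∃ V : Submodule ℝ T.Space, GW.IsInvariantRealForm (T.rep b) V) ↔
      (T.μ ≪ T.μ.map (1 - ·) ∧ T.μ.map (1 - ·) ≪ T.μ) ∧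
      (∀ᵐ x ∂T.μ, T.ν x = T.ν (1 - x)) ∧
      ∃ r : GW.Occ m → (GW.Ell2 →L⋆[ℂ] GW.Ell2),
        (∀ v, StronglyMeasurable fun x => r x v) ∧
        (∀ᵐ x ∂T.μ, ∀ v ∈ GW.fiber (T.ν x),
          r x v ∈ GW.fiber (T.ν (1 - x)) ∧ ‖r x v‖ = ‖v‖) ∧
        (∀ᵐ x ∂T.μ, ∀ v ∈ GW.fiber (T.ν x), r x (r (1 - x) v) = v) ∧
        (∀ k : GW.Idx m, ∀ᵐ x ∂T.μ, ∀ v ∈ GW.fiber (T.ν x),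
          r x (T.c k (1 - x) v) = (-1 : ℂ) ^ (k : ℕ) • T.c k x (r (x + GW.delta k) v)) := by
  simp only [GW.Occ.one_sub_eq]
  constructor
  · rintro ⟨V, hV⟩
    obtain ⟨r, hr, hrr, hrc⟩ := GW.Triple.exists_isReflection_of_realForm b hV
    refine ⟨⟨GW.Triple.absolutelyContinuous_map_reflect hr.ac, hr.ac⟩, ?_, r, hr.meas, ?_, hrr,
      hrc⟩
    · filter_upwards [hr.ν_eq] with x hx using hx.symm
    · filter_upwards [hr.ν_eq, hr.isom] with x hx h
      rwa [hx]
  · rintro ⟨⟨-, hac⟩, hν, r, hm, hisom, hrr, hrc⟩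
    have hr : T.IsReflection r := by
      refine ⟨hac, ?_, hm, ?_⟩
      · filter_upwards [hν] with x hx using hx.symm
      · filter_upwards [hν, hisom] with x hx h
        rwa [← hx] at h
    exact hr.exists_isInvariantRealForm hrr hrc b
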